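/- A permutation $\pi$ of $\{1,\dots,n\}$ contains a pattern $\tau$ (a permutation of $\{1,\dots,k\}$) if some subsequence of $\pi_1\pi_2\cdots\pi_n$ of length $k$ is order isomorphic to $\tau$; otherwise $\pi$ avoids $\tau$. For a set $T$ of patterns let $S_n(T)$ be the set of permutations of $\{1,\dots,n\}$ that avoid every pattern in $T$, and let $F_T(x)=\sum_{n\ge 0}|S_n(T)|\,x^n$. Theorem. Let $T=\{1342,2341,3412\}$. Then \[ F_T(x)=\frac{(1-2x)\big((1-5x+9x^2-6x^3)\sqrt{1-4x}-(1-9x+29x^2-38x^3+18x^4)\big)}{2(1-x)^2\,x\,(1-7x+14x^2-9x^3)}, \] as an identity of formal Laurent series over $\mathbb{Q}$, where $\sqrt{1-4x}$ is the formal power series with constant term $1$ whose square is $1-4x$. -/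

import Mathlib

open PowerSeries

noncomputable section

namespace PatternAvoidance

/-- The permutation `π` of `{0, …, n - 1}` contains the pattern `τ`, a word of length `k` with
distinct letters: some subsequence of `π 0, π 1, …, π (n - 1)` is order isomorphic to `τ`. -/
def Contains {n k : ℕ} (π : Equiv.Perm (Fin n)) (τ : Fin k → ℕ) : Prop :=
  ∃ f : Fin k → Fin n, StrictMono f ∧ ∀ a b : Fin k, π (f a) < π (f b) ↔ τ a < τ b

/-- The set `S_n(T)` of permutations of length `n` that avoid every pattern in `T`. -/
def avoiders {k : ℕ} (T : Set (Fin k → ℕ)) (n : ℕ) : Set (Equiv.Perm (Fin n)) :=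
  {π | ∀ τ ∈ T, ¬ Contains π τ}

/-- The generating function `F_T(x) = ∑_{n ≥ 0} |S_n(T)| x^n`. -/
def genFun {k : ℕ} (T : Set (Fin k → ℕ)) : ℚ⟦X⟧ :=
  PowerSeries.mk fun n => ((avoiders T n).ncard : ℚ)

/-- The power series `√(1 - 4x) = ∑_{n ≥ 0} binom(1/2, n) (-4x)^n`. -/
def sqrtOneSubFourX : ℚ⟦X⟧ :=
  PowerSeries.rescale (-4 : ℚ) (PowerSeries.binomialSeries ℚ (1 / 2 : ℚ))

theorem sqrtOneSubFourX_sq : sqrtOneSubFourX ^ 2 = 1 - 4 * X := by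
  have h : PowerSeries.binomialSeries ℚ (1 / 2 : ℚ) * PowerSeries.binomialSeries ℚ (1 / 2 : ℚ)
      = 1 + X := by
    rw [← PowerSeries.binomialSeries_add]
    have := PowerSeries.binomialSeries_nat (R := ℚ) (A := ℚ) 1
    norm_num at this ⊢
    exact this
  have h4 : (PowerSeries.C (-4 : ℚ)) = -4 := by
    rw [map_neg, map_ofNat]
  rw [sqrtOneSubFourX, sq, ← map_mul, h, map_add, map_one, PowerSeries.rescale_X, h4]
  ring

theorem constantCoeff_sqrtOneSubFourX : PowerSeries.constantCoeff sqrtOneSubFourX = 1 := by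
  rw [sqrtOneSubFourX, ← PowerSeries.coeff_zero_eq_constantCoeff_apply, PowerSeries.coeff_rescale]
  simp

/-- The pattern set `{1342, 2341, 3412}`. -/
def patterns : Set (Fin 4 → ℕ) := {![1, 3, 4, 2], ![2, 3, 4, 1], ![3, 4, 1, 2]}

end PatternAvoidance

end

/-! Permutations become words on 0, …, n-1. Together, 1342 and 2341 forbid a < b < c followed by a
letter below b. Split a nonempty avoider at its largest letter n as L n R. If L is empty, R is any
avoider. The others form `coreWords`, with series N, so F = 1 + xF + N.

If L = D is decreasing, the subsequences d n x y force every ascent top of R above D, and d x y z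
forbids a 231 in R whose middle letter exceeds some d. These pairs (D, R) are `weakSlopePairs`, with
series B. If L has an ascent, let b be its largest ascent top, with a < b before it. The subsequence
a b n r forces R above b, and the letters of L above b form a decreasing prefix D. The rest of L is
then a core word on exactly the letters up to b. Since it lies below R, the word R must avoid 231
outright, and (D, R) is one of the `slopePairs`, with series E. Hence N = xB + xNE (`coreWords_eq`,
`gf_coreWords`).

Let C = 1 + xC² count 231-avoiders. In a slope pair, either D is an initial segment of values and R
is any 231-avoider, or the letters of R below m = max D form one decreasing block. Collapsing that
block to a letter 0 leaves a nonempty 231-avoider and a nonempty set S of values below m. Thus E =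
C/(1-x) + (C-1) ∑ (2^m - 1) x^m.

In a weak pair, a letter of R between two letters of D makes full 231-avoidance automatic
(`mem_slopePairs_of_hasMid`), and the block description applies with S not an initial segment.
Otherwise D is an interval of values and R is one of the `thresholdWords`, with series H = 1 + xH +
xHC. Thus B = xH/(1-x) + (C-1) ∑ (2^m - m - 1) x^m. Since √(1-4x) = 1 - 2xC, elimination gives the
formula. -/

namespace PatternAvoidance

/-! ### Generating functions of graded sets -/

/-- The generating function of the set `s` graded by `size`. -/
noncomputable def gf {α : Type*} (size : α → ℕ) (s : Set α) : ℚ⟦X⟧ :=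
  PowerSeries.mk fun n => ({a | a ∈ s ∧ size a = n}.ncard : ℚ)

/-- Every graded piece of `s` is finite. -/
def GradedFinite {α : Type*} (size : α → ℕ) (s : Set α) : Prop :=
  ∀ n, {a | a ∈ s ∧ size a = n}.Finite

section Graded

variable {α β : Type*} {size : α → ℕ} {size' : β → ℕ}

theorem GradedFinite.mono {s t : Set α} (ht : GradedFinite size t) (h : s ⊆ t) :
    GradedFinite size s :=
  fun n => (ht n).subset fun _ ha => ⟨h ha.1, ha.2⟩

theorem GradedFinite.union {s t : Set α} (hs : GradedFinite size s) (ht : GradedFinite size t) :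
    GradedFinite size (s ∪ t) :=
  fun n => ((hs n).union (ht n)).subset fun _ ha => ha.1.imp (⟨·, ha.2⟩) (⟨·, ha.2⟩)

theorem gradedFinite_singleton (a : α) : GradedFinite size {a} :=
  fun _ => (Set.finite_singleton a).subset fun _ hb => hb.1

/-- `Set.ncard` is 0 on infinite sets, so additivity needs finite graded pieces; this is why
`GradedFinite` is carried along everywhere. -/
theorem gf_union {s t : Set α} (hs : GradedFinite size s) (ht : GradedFinite size t)
    (h : Disjoint s t) : gf size (s ∪ t) = gf size s + gf size t := by
  ext n
  simp only [gf, coeff_mk, map_add]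
  rw [← Nat.cast_add, ← Set.ncard_union_eq _ (hs n) (ht n)]
  · congr 2
    ext a
    simp only [Set.mem_union, Set.mem_ofPred_eq]
    tauto
  · exact h.mono (fun _ ha => ha.1) (fun _ ha => ha.1)

theorem gf_singleton (a : α) : gf size {a} = X ^ size a := by
  ext n
  rw [gf, coeff_mk, coeff_X_pow]
  split_ifs with h
  · rw [show {b | b ∈ ({a} : Set α) ∧ size b = n} = {a} by ext b; simp; rintro rfl; exact h.symm]
    simp
  · rw [show {b | b ∈ ({a} : Set α) ∧ size b = n} = ∅ by ext b; simp; rintro rfl; exact fun e => h e.symm]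
    simp

theorem image_graded {f : α → β} {s : Set α} {k : ℕ}
    (hk : ∀ a ∈ s, size' (f a) = size a + k) (n : ℕ) :
    {b | b ∈ f '' s ∧ size' b = n + k} = f '' {a | a ∈ s ∧ size a = n} := by
  ext b
  constructor
  · rintro ⟨⟨a, ha, rfl⟩, h⟩
    exact ⟨a, ⟨ha, by have := hk a ha; lia⟩, rfl⟩
  · rintro ⟨a, ⟨ha, h⟩, rfl⟩
    exact ⟨⟨a, ha, rfl⟩, by rw [hk a ha, h]⟩

theorem image_graded_of_lt {f : α → β} {s : Set α} {k n : ℕ}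
    (hk : ∀ a ∈ s, size' (f a) = size a + k) (hn : n < k) :
    {b | b ∈ f '' s ∧ size' b = n} = ∅ := by
  ext b
  simp only [Set.mem_ofPred_eq, Set.mem_empty_iff_false, iff_false, not_and]
  rintro ⟨a, ha, rfl⟩ h
  have := hk a ha
  lia

theorem GradedFinite.image {f : α → β} {s : Set α} {k : ℕ} (hs : GradedFinite size s)
    (hk : ∀ a ∈ s, size' (f a) = size a + k) : GradedFinite size' (f '' s) := by
  intro n
  by_cases hn : n < k
  · rw [image_graded_of_lt hk hn]
    exact Set.finite_empty
  · obtain ⟨m, rfl⟩ := Nat.exists_eq_add_of_le' (not_lt.1 hn)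
    rw [image_graded hk]
    exact (hs m).image f

theorem gf_image {f : α → β} {s : Set α} {k : ℕ} (hf : Set.InjOn f s)
    (hk : ∀ a ∈ s, size' (f a) = size a + k) : gf size' (f '' s) = X ^ k * gf size s := by
  ext n
  rw [coeff_X_pow_mul', gf, gf, coeff_mk]
  split_ifs with hn
  · obtain ⟨m, rfl⟩ := Nat.exists_eq_add_of_le' hn
    rw [image_graded hk, Nat.add_sub_cancel, coeff_mk,
      (hf.mono fun _ ha => ha.1).ncard_image]
  · rw [image_graded_of_lt hk (not_le.1 hn)]
    simp

theorem prod_graded (s : Set α) (t : Set β) (n : ℕ) :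
    {p : α × β | p ∈ s ×ˢ t ∧ size p.1 + size' p.2 = n} =
      ⋃ ij ∈ Finset.HasAntidiagonal.antidiagonal n,
        {a | a ∈ s ∧ size a = ij.1} ×ˢ {b | b ∈ t ∧ size' b = ij.2} := by
  ext ⟨a, b⟩
  simp only [Set.mem_prod, Set.mem_ofPred_eq, Set.mem_iUnion, Finset.HasAntidiagonal.mem_antidiagonal, exists_prop,
    Prod.exists]
  constructor
  · rintro ⟨⟨ha, hb⟩, h⟩
    exact ⟨_, _, h, ⟨ha, rfl⟩, hb, rfl⟩
  · rintro ⟨i, j, h, ⟨ha, rfl⟩, hb, rfl⟩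
    exact ⟨⟨ha, hb⟩, h⟩

theorem GradedFinite.prod {s : Set α} {t : Set β} (hs : GradedFinite size s)
    (ht : GradedFinite size' t) :
    GradedFinite (fun p : α × β => size p.1 + size' p.2) (s ×ˢ t) := by
  intro n
  rw [prod_graded]
  exact Set.Finite.biUnion (Finset.finite_toSet _) fun ij _ => (hs _).prod (ht _)

open Classical in
theorem gf_prod {s : Set α} {t : Set β} (hs : GradedFinite size s) (ht : GradedFinite size' t) :
    gf (fun p : α × β => size p.1 + size' p.2) (s ×ˢ t) = gf size s * gf size' t := by
  ext n
  have hfin : ∀ ij : ℕ × ℕ, ({a | a ∈ s ∧ size a = ij.1} ×ˢ {b | b ∈ t ∧ size' b = ij.2}).Finite :=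
    fun ij => (hs _).prod (ht _)
  have key : (⋃ ij ∈ Finset.HasAntidiagonal.antidiagonal n,
      {a | a ∈ s ∧ size a = ij.1} ×ˢ {b | b ∈ t ∧ size' b = ij.2}) =
      ((Finset.HasAntidiagonal.antidiagonal n).biUnion fun ij => (hfin ij).toFinset : Set (α × β)) := by
    ext p
    simp only [Finset.coe_biUnion, Set.Finite.coe_toFinset, Finset.mem_coe]
  rw [coeff_mul, gf, coeff_mk, prod_graded, key, Set.ncard_coe_finset, Finset.card_biUnion,
    Nat.cast_sum]
  · refine Finset.sum_congr rfl fun ij _ => ?_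
    rw [← Set.ncard_eq_toFinset_card _ (hfin ij)]
    simp only [gf, coeff_mk, Set.ncard_prod, Nat.cast_mul]
  · rintro ⟨i, j⟩ _ ⟨i', j'⟩ _ hne
    refine Finset.disjoint_left.2 ?_
    simp only [Set.Finite.mem_toFinset]
    rintro ⟨a, b⟩ ⟨⟨_, h1⟩, _, h2⟩ ⟨⟨_, h3⟩, _, h4⟩
    simp only at h1 h2 h3 h4
    exact hne (by rw [← h1, ← h2, ← h3, ← h4])

end Graded

/-! ### Words -/

/-- `l` is a word in which each of the letters `0, …, l.length - 1` occurs exactly once. -/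
def Std (l : List ℕ) : Prop := l.Nodup ∧ ∀ x, x ∈ l ↔ x < l.length

theorem std_of_mem {l : List ℕ} {n : ℕ} (h : l.Nodup) (hl : ∀ x, x ∈ l ↔ x < n) :
    Std l ∧ l.length = n := by
  have : l.Perm (List.range n) :=
    (List.perm_ext_iff_of_nodup h List.nodup_range).2 (by simpa using hl)
  have h2 : l.length = n := by simpa using this.length_eq
  exact ⟨⟨h, h2 ▸ hl⟩, h2⟩

theorem Std.perm {l : List ℕ} (h : Std l) : l.Perm (List.range l.length) :=
  (List.perm_ext_iff_of_nodup h.1 List.nodup_range).2 (by simpa using h.2)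

/-- Pigeonhole: distinct letters below the length already exhaust the range. -/
theorem std_of_lt {l : List ℕ} (h : l.Nodup) (hl : ∀ x ∈ l, x < l.length) : Std l := by
  have : l.Perm (List.range l.length) :=
    List.Subperm.perm_of_length_le (List.subperm_of_subset h (by intro x hx; simpa using hl x hx))
      (by simp)
  exact ⟨h, fun x => by rw [this.mem_iff, List.mem_range]⟩

theorem std_nil : Std [] := by simp [Std]

theorem gradedFinite_std : GradedFinite List.length {l | Std l} := by
  intro n
  refine (List.finite_toSet ((List.range n).permutations)).subset ?_
  rintro l ⟨hl, rfl⟩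
  exact List.mem_permutations.2 hl.perm

/-- The word `l` contains none of `1342`, `2341`, `3412`. -/
def Avoid (l : List ℕ) : Prop :=
  ∀ a b c d, [a, b, c, d].Sublist l → ¬ (a < b ∧ b < c ∧ d < b) ∧ ¬ (a < b ∧ c < d ∧ d < a)

/-! ### Permutations as words -/

theorem sublist_ofFn_iff {n : ℕ} (g : Fin n → ℕ) (l : List ℕ) :
    l.Sublist (List.ofFn g) ↔
      ∃ f : Fin l.length → Fin n, StrictMono f ∧ ∀ i, l.get i = g (f i) := by
  rw [List.sublist_iff_exists_fin_orderEmbedding_get_eq]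
  constructor
  · rintro ⟨f, hf⟩
    refine ⟨fun i => Fin.cast (by simp) (f i), fun i j h => ?_, fun i => ?_⟩
    · exact f.strictMono h
    · rw [hf i]
      simp
      rfl
  · rintro ⟨f, hf, h⟩
    refine ⟨OrderEmbedding.ofStrictMono (fun i => Fin.cast (by simp) (f i)) fun i j hij => ?_,
      fun i => ?_⟩
    · exact hf hij
    · rw [h i]
      simp
      rfl

/-- The word `π 0, π 1, …, π (n - 1)`. -/
def word {n : ℕ} (π : Equiv.Perm (Fin n)) : List ℕ := List.ofFn fun i => (π i : ℕ)

theorem length_word {n : ℕ} (π : Equiv.Perm (Fin n)) : (word π).length = n := by simp [word]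

theorem std_word {n : ℕ} (π : Equiv.Perm (Fin n)) : Std (word π) := by
  refine std_of_lt ?_ ?_
  · exact List.nodup_ofFn.2 (Fin.val_injective.comp π.injective)
  · simp [word, List.mem_ofFn]

theorem word_injective (n : ℕ) : Function.Injective (word (n := n)) := by
  intro π ρ h
  have := List.ofFn_injective h
  ext i
  exact congrFun this i

theorem exists_word_eq {l : List ℕ} (hl : Std l) :
    ∃ π : Equiv.Perm (Fin l.length), word π = l := by
  let f : Fin l.length → Fin l.length := fun i => ⟨l.get i, (hl.2 _).1 (l.get_mem i)⟩
  have hf : Function.Injective f := fun i j h =>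
    List.nodup_iff_injective_get.1 hl.1 (by simpa [f] using h)
  refine ⟨Equiv.ofBijective f (Finite.injective_iff_bijective.1 hf), ?_⟩
  simp [word, f]

theorem contains_iff {n : ℕ} (π : Equiv.Perm (Fin n)) (τ : Fin 4 → ℕ) :
    Contains π τ ↔ ∃ w : Fin 4 → ℕ, [w 0, w 1, w 2, w 3].Sublist (word π) ∧
      ∀ a b : Fin 4, w a < w b ↔ τ a < τ b := by
  constructor
  · rintro ⟨f, hf, h⟩
    refine ⟨fun i => (π (f i) : ℕ), (sublist_ofFn_iff _ _).2 ⟨f, hf, ?_⟩, h⟩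
    intro i
    fin_cases i <;> rfl
  · rintro ⟨w, hw, h⟩
    obtain ⟨f, hf, hfw⟩ := (sublist_ofFn_iff _ _).1 hw
    have key : ∀ i : Fin 4, w i = (π (f i) : ℕ) := by
      intro i
      rw [← hfw i]
      fin_cases i <;> rfl
    refine ⟨f, hf, fun a b => ?_⟩
    rw [← h a b, key, key]
    rfl

/-- When a < b < c and d < b, the letters form 1342 or 2341 according to whether a < d or d < a.
Distinctness excludes a = d, so two conditions cover three patterns. -/
theorem mem_avoiders_patterns_iff {n : ℕ} (π : Equiv.Perm (Fin n)) :
    π ∈ avoiders patterns n ↔ Avoid (word π) := by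
  have hp : π ∈ avoiders patterns n ↔ ¬ Contains π ![1, 3, 4, 2] ∧ ¬ Contains π ![2, 3, 4, 1] ∧
      ¬ Contains π ![3, 4, 1, 2] := by
    simp [avoiders, patterns]
  rw [hp, contains_iff, contains_iff, contains_iff]
  simp only [Fin.forall_fin_succ, Fin.forall_fin_zero]
  simp
  constructor
  · rintro ⟨h1, h2, h3⟩ a b c d hs
    have hn : [a, b, c, d].Nodup := (std_word π).1.sublist hs
    have e1 := h1 ![a, b, c, d] hs
    have e2 := h2 ![a, b, c, d] hs
    have e3 := h3 ![a, b, c, d] hs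
    simp at e1 e2 e3 hn
    grind
  · intro h
    refine ⟨fun w hs => ?_, fun w hs => ?_, fun w hs => ?_⟩ <;> have := h _ _ _ _ hs <;> grind

theorem genFun_patterns : genFun patterns = gf List.length {l | Std l ∧ Avoid l} := by
  ext n
  rw [genFun, gf, coeff_mk, coeff_mk, ← Set.ncard_image_of_injective _ (word_injective n)]
  congr 2
  ext l
  constructor
  · rintro ⟨π, hπ, rfl⟩
    exact ⟨⟨std_word π, (mem_avoiders_patterns_iff π).1 hπ⟩, length_word π⟩
  · rintro ⟨⟨hl, ha⟩, rfl⟩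
    obtain ⟨π, hπ⟩ := exists_word_eq hl
    exact ⟨π, (mem_avoiders_patterns_iff π).2 (by rwa [hπ]), hπ⟩

/-! ### Words avoiding `231`, with a decreasing set of small letters -/

/-- The top letter of each ascent (as a pattern of length two) of `l` is at least `p`. -/
def AscGe (p : ℕ) (l : List ℕ) : Prop := l.Pairwise fun x y => x < y → p ≤ y

/-- No occurrence of `231` in `l` has its middle letter at least `q`. -/
def NoDip (q : ℕ) (l : List ℕ) : Prop := l.Triplewise fun x y z => q ≤ x → x < y → x ≤ z

/-- The `231`-avoiding words. -/
def catWords : Set (List ℕ) := {R | Std R ∧ NoDip 0 R}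

/-- The words with a threshold `p`, in which the letters below `p` decrease and in which no
occurrence of `231` has its middle letter at least `p`. -/
def thresholdWords : Set (ℕ × List ℕ) :=
  {w | Std w.2 ∧ w.1 ≤ w.2.length ∧ AscGe w.1 w.2 ∧ NoDip w.1 w.2}

/-- The strictly monotone map that leaves out the values `p, …, p + k - 1`. -/
def raise (p k v : ℕ) : ℕ := if v < p then v else v + k

theorem raise_injective (p k : ℕ) : Function.Injective (raise p k) := by
  intro v w h
  grind [raise]

theorem map_raise_injective (p k : ℕ) : Function.Injective (List.map (raise p k)) :=
  List.map_injective_iff.2 (raise_injective p k)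

theorem exists_map_raise_eq {p k : ℕ} {t : List ℕ} (ht : ∀ x ∈ t, x < p ∨ p + k ≤ x) :
    ∃ R : List ℕ, t = R.map (raise p k) := by
  refine ⟨t.map fun v => if v < p then v else v - k, ?_⟩
  rw [List.map_map]
  conv_lhs => rw [← List.map_id t]
  refine List.map_congr_left fun x hx => ?_
  have := ht x hx
  simp only [id, Function.comp, raise]
  grind

theorem exists_map_add_eq {k : ℕ} {t : List ℕ} (ht : ∀ x ∈ t, k ≤ x) :
    ∃ R : List ℕ, t = R.map (· + k) := by
  refine ⟨t.map (· - k), ?_⟩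
  rw [List.map_map]
  conv_lhs => rw [← List.map_id t]
  refine List.map_congr_left fun x hx => ?_
  have := ht x hx
  simp only [id, Function.comp]
  lia

theorem map_add_injective (k : ℕ) : Function.Injective (List.map (· + k)) :=
  List.map_injective_iff.2 (add_left_injective k)

theorem noDip_map_add {q k : ℕ} {R : List ℕ} (h : q ≤ k) :
    NoDip q (R.map (· + k)) ↔ NoDip 0 R := by
  rw [NoDip, NoDip, List.triplewise_map]
  constructor <;> intro h' <;> refine h'.imp fun h' => ?_ <;> intros <;> grind

/-- Once `P` holds it persists, so the cut is at the first letter satisfying it. Used to separate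
small letters from large ones. -/
theorem exists_append_of_pairwise {P : ℕ → Prop} {t : List ℕ}
    (h : t.Pairwise fun y z => P y → P z) :
    ∃ t₁ t₂, t = t₁ ++ t₂ ∧ (∀ x ∈ t₁, ¬ P x) ∧ ∀ x ∈ t₂, P x := by
  induction t with
  | nil => exact ⟨[], [], by simp⟩
  | cons a t ih =>
    rw [List.pairwise_cons] at h
    by_cases ha : P a
    · exact ⟨[], a :: t, by simpa using ⟨ha, fun x hx => h.1 x hx ha⟩⟩
    · obtain ⟨t₁, t₂, rfl, h1, h2⟩ := ih h.2
      exact ⟨a :: t₁, t₂, by simp, by grind, h2⟩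

/-! ### Splitting a threshold word at its first letter -/

theorem std_cons_append_iff {R₁ R₂ : List ℕ} {a : ℕ} (ha : ∀ x ∈ R₁, x < a) :
    Std (a :: (R₁ ++ R₂.map (· + (a + 1)))) ↔ Std R₁ ∧ Std R₂ ∧ R₁.length = a := by
  constructor
  · rintro ⟨h1, h2⟩
    have key : Std R₁ ∧ R₁.length = a := by
      refine std_of_mem (by grind) fun x => ⟨ha x, fun hx => ?_⟩
      have := (h2 x).1
      have := h2 x
      have h3 := (h2 a).1 (by simp)
      have := this.2 (by lia)
      simp at this
      grind
    refine ⟨key.1, ?_, key.2⟩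
    have h3 : (R₂.map (· + (a + 1))).Nodup := by grind
    refine (std_of_mem (n := R₂.length) (h3.of_map _) fun x => ?_).1
    have h4 := h2 (x + (a + 1))
    simp at h4
    grind
  · rintro ⟨⟨h1, h2⟩, ⟨h3, h4⟩, rfl⟩
    refine std_of_lt ?_ ?_
    · have := h3.map (add_left_injective (R₁.length + 1))
      grind
    · simp
      grind

/-- Small letters stand before large ones, so no violation straddles the two parts. The second part
lies above `a ≥ p`: there the ascent condition is void and the dip condition is full 231-avoidance.
-/
theorem mem_thresholdWords_big {p a : ℕ} {R₁ R₂ : List ℕ} (hp : p ≤ a) (ha : ∀ x ∈ R₁, x < a) :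
    (p, a :: (R₁ ++ R₂.map (· + (a + 1)))) ∈ thresholdWords ↔
      (p, R₁) ∈ thresholdWords ∧ R₂ ∈ catWords ∧ R₁.length = a := by
  simp only [thresholdWords, catWords, Set.mem_ofPred_eq, std_cons_append_iff ha]
  have h1 : AscGe p (a :: (R₁ ++ R₂.map (· + (a + 1)))) ↔ AscGe p R₁ := by
    simp only [AscGe, List.pairwise_cons, List.pairwise_append, List.pairwise_map]
    refine ⟨fun h => h.2.1, fun h => ⟨by grind, h, ?_, ?_⟩⟩
    · exact List.pairwise_of_forall_mem_list (by grind)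
    · simp
      grind
  have h2 : NoDip p (a :: (R₁ ++ R₂.map (· + (a + 1)))) ↔ NoDip p R₁ ∧ NoDip 0 R₂ := by
    rw [← noDip_map_add (R := R₂) (q := p) (k := a + 1) (by lia)]
    simp only [NoDip, List.triplewise_cons, List.triplewise_append, List.pairwise_append]
    refine ⟨fun h => ⟨h.2.1, h.2.2.1⟩, fun h => ⟨⟨?_, ?_, ?_⟩, h.1, h.2, ?_, ?_⟩⟩
    · exact List.pairwise_of_forall_mem_list (by grind)
    · exact List.pairwise_of_forall_mem_list (by grind)
    · grind
    · exact fun x hx => List.pairwise_of_forall_mem_list (by grind)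
    · exact fun x hx => List.pairwise_of_forall_mem_list (by grind)
  rw [h1, h2]
  clear h1 h2
  constructor
  · rintro ⟨⟨h1, h2, rfl⟩, h3, h4, h5, h6⟩
    exact ⟨⟨h1, hp, h4, h5⟩, ⟨h2, h6⟩, rfl⟩
  · rintro ⟨⟨h1, h2, h3, h4⟩, ⟨h5, h6⟩, rfl⟩
    exact ⟨⟨h1, h5, rfl⟩, by simp; lia, h3, h4, h6⟩

/-- A letter above `a` followed by one below it would make a 231 with middle letter `a ≥ p`; hence
the letters below `a` come first. -/
theorem exists_of_mem_thresholdWords_big {p a : ℕ} {t : List ℕ}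
    (h : (p, a :: t) ∈ thresholdWords) (hp : p ≤ a) :
    ∃ R₁ R₂, t = R₁ ++ R₂.map (· + (a + 1)) ∧ (p, R₁) ∈ thresholdWords ∧ R₂ ∈ catWords ∧
      R₁.length = a := by
  obtain ⟨hs, -, -, hd⟩ := id h
  simp only [NoDip, List.triplewise_cons] at hd
  have hat : a ∉ t := (List.nodup_cons.1 hs.1).1
  obtain ⟨t₁, t₂, rfl, h1, h2⟩ := exists_append_of_pairwise (P := fun x => a ≤ x) (t := t) (by
    refine hd.1.imp_of_mem fun {x y} hx hy hxy => ?_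
    grind)
  obtain ⟨R₂, rfl⟩ := exists_map_add_eq (k := a + 1) (t := t₂) (by grind)
  have ha : ∀ x ∈ t₁, x < a := by grind
  exact ⟨t₁, R₂, rfl, (mem_thresholdWords_big hp ha).1 h⟩

theorem std_append_raise_iff {p k : ℕ} {D R : List ℕ} (hD : D.Nodup)
    (hmem : ∀ x, x ∈ D ↔ p ≤ x ∧ x < p + k) (hp : p ≤ R.length) :
    Std (D ++ R.map (raise p k)) ↔ Std R := by
  have hk : D.length = k := by
    have : D.Perm (List.range' p k) :=
      (List.perm_ext_iff_of_nodup hD List.nodup_range').2 fun x => by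
        rw [hmem, List.mem_range'_1]
    simpa using this.length_eq
  constructor
  · rintro ⟨h1, h2⟩
    have h3 : (R.map (raise p k)).Nodup := (List.nodup_append.1 h1).2.1
    refine std_of_lt (h3.of_map _) fun x hx => ?_
    have := (h2 (raise p k x)).1 (by simp; grind)
    simp only [raise] at this
    grind
  · rintro ⟨h1, h2⟩
    have h3 := h1.map (raise_injective p k)
    refine std_of_lt ?_ ?_
    · refine List.nodup_append.2 ⟨hD, h3, ?_⟩
      simp only [List.mem_map]
      rintro a ha b ⟨c, hc, rfl⟩ rfl
      have := (hmem _).1 ha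
      grind [raise]
    · simp only [List.mem_append, List.mem_map, List.length_append, List.length_map]
      rintro x (hx | ⟨c, hc, rfl⟩)
      · grind
      · have := (h2 c).1 hc
        grind [raise]

/-- The new first letter is below the new threshold, so triples starting with it are exempt, and any
ascent from it automatically has a top of at least `p + 1`. -/
theorem mem_thresholdWords_small {p : ℕ} {R : List ℕ} :
    (p + 1, p :: R.map (raise p 1)) ∈ thresholdWords ↔ (p, R) ∈ thresholdWords := by
  simp only [thresholdWords, Set.mem_ofPred_eq, List.length_cons, List.length_map,
    add_le_add_iff_right]
  have h0 (hp : p ≤ R.length) : Std (p :: R.map (raise p 1)) ↔ Std R :=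
    std_append_raise_iff (D := [p]) (by simp) (by simp; lia) hp
  have h1 : AscGe (p + 1) (p :: R.map (raise p 1)) ↔ AscGe p R := by
    simp only [AscGe, List.pairwise_cons, List.pairwise_map]
    constructor
    · refine fun h => h.2.imp fun {x y} hxy => ?_
      grind [raise]
    · refine fun h => ⟨by grind, h.imp fun {x y} hxy => ?_⟩
      grind [raise]
  have h2 : NoDip (p + 1) (p :: R.map (raise p 1)) ↔ NoDip p R := by
    simp only [NoDip, List.triplewise_cons, List.triplewise_map]
    constructor
    · refine fun h => h.2.imp fun {x y z} hxy => ?_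
      grind [raise]
    · refine fun h => ⟨List.pairwise_of_forall_mem_list (by grind), h.imp fun {x y z} hxy => ?_⟩
      grind [raise]
  rw [h1, h2]
  grind

theorem exists_of_mem_thresholdWords_small {p a : ℕ} {t : List ℕ}
    (h : (p, a :: t) ∈ thresholdWords) (hp : a < p) :
    ∃ R, t = R.map (raise a 1) ∧ p = a + 1 ∧ (a, R) ∈ thresholdWords := by
  obtain ⟨hs, hl, ha, -⟩ := id h
  simp only [AscGe, List.pairwise_cons] at ha hl
  -- If `a + 1 < p`, the letter `a + 1` occurs later and is an ascent top below the threshold.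
  have hpa : p = a + 1 := by
    by_contra hne
    have h1 := (hs.2 (a + 1)).2 (by lia)
    have := ha.1 (a + 1) (by grind)
    lia
  have hat : a ∉ t := (List.nodup_cons.1 hs.1).1
  obtain ⟨R, rfl⟩ := exists_map_raise_eq (p := a) (k := 1) (t := t) (by grind)
  subst hpa
  exact ⟨R, rfl, rfl, mem_thresholdWords_small.1 h⟩

/-! ### Functional equations for threshold words and 231-avoiders -/

theorem zero_mem_thresholdWords_iff {R : List ℕ} : (0, R) ∈ thresholdWords ↔ R ∈ catWords := by
  simp [thresholdWords, catWords, AscGe, List.pairwise_of_forall]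

theorem gradedFinite_catWords : GradedFinite List.length catWords :=
  gradedFinite_std.mono fun _ h => h.1

theorem gradedFinite_thresholdWords :
    GradedFinite (fun w : ℕ × List ℕ => w.2.length) thresholdWords := by
  intro n
  refine ((Set.finite_Iic n).prod (gradedFinite_std n)).subset ?_
  rintro ⟨p, R⟩ ⟨h, rfl⟩
  exact ⟨h.2.1, h.1, rfl⟩

theorem gf_thresholdWords :
    gf (fun w : ℕ × List ℕ => w.2.length) thresholdWords =
      1 + X * gf (fun w : ℕ × List ℕ => w.2.length) thresholdWords +
        X * (gf (fun w : ℕ × List ℕ => w.2.length) thresholdWords *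
          gf List.length catWords) := by
  set f : ℕ × List ℕ → ℕ × List ℕ := fun w => (w.1 + 1, w.1 :: w.2.map (raise w.1 1)) with hf
  set g : (ℕ × List ℕ) × List ℕ → ℕ × List ℕ := fun w =>
    (w.1.1, w.1.2.length :: (w.1.2 ++ w.2.map (· + (w.1.2.length + 1)))) with hg
  have key : thresholdWords = {(0, [])} ∪ f '' thresholdWords ∪ g '' (thresholdWords ×ˢ catWords) := by
    ext ⟨p, R⟩
    constructor
    · intro h
      rcases R with _ | ⟨a, t⟩
      · have := h.2.1
        simp at this
        simp [this]
      · rcases lt_or_ge a p with hap | hap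
        · obtain ⟨R, rfl, rfl, hR⟩ := exists_of_mem_thresholdWords_small h hap
          exact Or.inl (Or.inr ⟨(a, R), hR, rfl⟩)
        · obtain ⟨R₁, R₂, rfl, h1, h2, rfl⟩ := exists_of_mem_thresholdWords_big h hap
          exact Or.inr ⟨((p, R₁), R₂), ⟨h1, h2⟩, rfl⟩
    · rintro ((h | ⟨⟨q, R⟩, h, he⟩) | ⟨⟨⟨q, R₁⟩, R₂⟩, h, he⟩)
      · obtain ⟨rfl, rfl⟩ := Prod.mk.inj h
        exact zero_mem_thresholdWords_iff.2 ⟨std_nil, .nil⟩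
      · rw [← he]
        exact mem_thresholdWords_small.2 h
      · rw [← he]
        exact (mem_thresholdWords_big h.1.2.1 fun x hx => (h.1.1.2 x).1 hx).2 ⟨h.1, h.2, rfl⟩
  have hfi : Set.InjOn f thresholdWords := by
    rintro ⟨p, R⟩ - ⟨p', R'⟩ - h
    simp only [hf, Prod.mk.injEq, List.cons.injEq] at h
    obtain ⟨-, rfl, h⟩ := h
    rw [map_raise_injective _ _ h]
  have hgi : Set.InjOn g (thresholdWords ×ˢ catWords) := by
    rintro ⟨⟨p, R⟩, S⟩ - ⟨⟨p', R'⟩, S'⟩ - h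
    simp only [hg, Prod.mk.injEq, List.cons.injEq] at h
    obtain ⟨rfl, hl, h⟩ := h
    obtain ⟨rfl, h⟩ := List.append_inj h hl
    rw [map_add_injective _ h]
  have hfs : ∀ w ∈ thresholdWords, (f w).2.length = w.2.length + 1 := by simp [hf]
  have hgs : ∀ w ∈ thresholdWords ×ˢ catWords,
      (g w).2.length = (w.1.2.length + w.2.length) + 1 := by simp [hg]
  have hF := gradedFinite_thresholdWords
  have hP := gradedFinite_thresholdWords.prod gradedFinite_catWords
  conv_lhs => rw [key]
  rw [gf_union, gf_union, gf_singleton,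
    gf_image (size' := fun w : ℕ × List ℕ => w.2.length) (size := fun w : ℕ × List ℕ => w.2.length)
      hfi hfs,
    gf_image (size' := fun w : ℕ × List ℕ => w.2.length)
      (size := fun w : (ℕ × List ℕ) × List ℕ => w.1.2.length + w.2.length) hgi hgs,
    gf_prod (size := fun w : ℕ × List ℕ => w.2.length) (size' := List.length) hF
      gradedFinite_catWords, pow_one]
  · simp
  · exact gradedFinite_singleton _
  · exact hF.image hfs
  · refine Set.disjoint_left.2 ?_
    rintro _ rfl ⟨⟨p, R⟩, -, h⟩
    simp [hf] at h
  · exact (gradedFinite_singleton _).union (hF.image hfs)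
  · exact hP.image hgs
  · refine Set.disjoint_left.2 ?_
    rintro _ (rfl | ⟨⟨p, R⟩, h0, rfl⟩) ⟨⟨⟨p', R'⟩, S⟩, ⟨h1, -⟩, h⟩
    · simp [hg] at h
    -- The first letter is below the threshold in the image of `f`, and at least the threshold in
    -- that of `g`.
    · simp [hf, hg] at h
      have := h1.2.1
      simp at this
      lia

theorem gf_catWords :
    gf List.length catWords = 1 + X * (gf List.length catWords * gf List.length catWords) := by
  set g : List ℕ × List ℕ → List ℕ := fun w =>
    w.1.length :: (w.1 ++ w.2.map (· + (w.1.length + 1))) with hg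
  have key : catWords = {[]} ∪ g '' (catWords ×ˢ catWords) := by
    ext R
    constructor
    · intro h
      rcases R with _ | ⟨a, t⟩
      · exact Or.inl rfl
      · obtain ⟨R₁, R₂, rfl, h1, h2, rfl⟩ :=
          exists_of_mem_thresholdWords_big (zero_mem_thresholdWords_iff.2 h) (Nat.zero_le a)
        exact Or.inr ⟨(R₁, R₂), ⟨zero_mem_thresholdWords_iff.1 h1, h2⟩, rfl⟩
    · rintro (rfl | ⟨⟨R₁, R₂⟩, h, rfl⟩)
      · exact ⟨std_nil, .nil⟩
      · exact zero_mem_thresholdWords_iff.1 ((mem_thresholdWords_big (Nat.zero_le _)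
          fun x hx => (h.1.1.2 x).1 hx).2 ⟨zero_mem_thresholdWords_iff.2 h.1, h.2, rfl⟩)
  have hgi : Set.InjOn g (catWords ×ˢ catWords) := by
    rintro ⟨R, S⟩ - ⟨R', S'⟩ - h
    simp only [hg, List.cons.injEq] at h
    obtain ⟨hl, h⟩ := h
    obtain ⟨rfl, h⟩ := List.append_inj h hl
    rw [map_add_injective _ h]
  have hgs : ∀ w ∈ catWords ×ˢ catWords, (g w).length = (w.1.length + w.2.length) + 1 := by
    simp [hg]
  have hC := gradedFinite_catWords
  conv_lhs => rw [key]
  rw [gf_union, gf_singleton,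
    gf_image (size := fun w : List ℕ × List ℕ => w.1.length + w.2.length) hgi hgs,
    gf_prod hC hC, pow_one]
  · simp
  · exact gradedFinite_singleton _
  · exact (hC.prod hC).image hgs
  · refine Set.disjoint_left.2 ?_
    rintro _ rfl ⟨w, -, h⟩
    simp [hg] at h

/-! ### Pairs of a decreasing word and a word avoiding `231` -/

/-- The cut is at the first letter failing `P`, hence determined by the word. This gives uniqueness
in the decompositions below. -/
theorem append_cons_inj {P : ℕ → Prop} {l₁ l₂ t₁ t₂ : List ℕ} {a₁ a₂ : ℕ}
    (h₁ : ∀ x ∈ l₁, P x) (h₂ : ∀ x ∈ l₂, P x) (ha₁ : ¬ P a₁) (ha₂ : ¬ P a₂)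
    (h : l₁ ++ a₁ :: t₁ = l₂ ++ a₂ :: t₂) : l₁ = l₂ ∧ a₁ = a₂ ∧ t₁ = t₂ := by
  induction l₁ generalizing l₂ with
  | nil => cases l₂ <;> grind
  | cons b l₁ ih =>
    rcases l₂ with _ | ⟨c, l₂⟩
    · grind
    · have := @ih l₂ (by grind) (by grind) (by grind)
      grind

theorem eq_of_pairwise_gt {l₁ l₂ : List ℕ} (h₁ : l₁.Pairwise (· > ·)) (h₂ : l₂.Pairwise (· > ·))
    (h : ∀ x, x ∈ l₁ ↔ x ∈ l₂) : l₁ = l₂ :=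
  h₁.eq_of_mem_iff h₂ @h

theorem nodup_of_pairwise_gt {l : List ℕ} (h : l.Pairwise (· > ·)) : l.Nodup :=
  h.imp fun h => h.ne'

/-- The pairs `(D, R)` with `D` decreasing, `R` avoiding `231`, and every ascent top of `R` above
all letters of `D`. -/
def slopePairs : Set (List ℕ × List ℕ) :=
  {w | Std (w.1 ++ w.2) ∧ w.1.Pairwise (· > ·) ∧ NoDip 0 w.2 ∧ ∀ d ∈ w.1, AscGe d w.2}

/-- The pairs `(D, R)` with `D` decreasing and nonempty, every ascent top of `R` above all letters
of `D`, and no occurrence of `231` in `R` having its middle letter above a letter of `D`. -/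
def weakSlopePairs : Set (List ℕ × List ℕ) :=
  {w | w.1 ≠ [] ∧ Std (w.1 ++ w.2) ∧ w.1.Pairwise (· > ·) ∧
    ∀ d ∈ w.1, AscGe d w.2 ∧ NoDip d w.2}

/-- Some letter of the second word lies below a letter of the first word. -/
def HasLow (w : List ℕ × List ℕ) : Prop := ∃ r ∈ w.2, ∃ d ∈ w.1, r < d

/-- Some letter of the second word lies between two letters of the first word. -/
def HasMid (w : List ℕ × List ℕ) : Prop := ∃ r ∈ w.2, ∃ d ∈ w.1, ∃ e ∈ w.1, e < r ∧ r < d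

theorem AscGe.mono {p q : ℕ} {l : List ℕ} (h : AscGe p l) (hq : q ≤ p) : AscGe q l :=
  h.imp fun h hlt => hq.trans (h hlt)

theorem NoDip.mono {p q : ℕ} {l : List ℕ} (h : NoDip p l) (hq : p ≤ q) : NoDip q l :=
  List.Triplewise.imp (fun h hx => h (hq.trans hx)) h

theorem triplewise_iff_forall_sublist {P : ℕ → ℕ → ℕ → Prop} {l : List ℕ} :
    l.Triplewise P ↔ ∀ x y z, [x, y, z].Sublist l → P x y z := by
  induction l with
  | nil => simp
  | cons a l ih =>
    rw [List.triplewise_cons, ih, List.pairwise_iff_forall_sublist]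
    constructor
    · rintro ⟨h1, h2⟩ x y z h
      rcases List.cons_sublist_cons'.1 h with h' | ⟨rfl, h'⟩
      · exact h2 _ _ _ h'
      · exact h1 h'
    · exact fun h => ⟨fun {y z} hyz => h _ _ _ (hyz.cons_cons a), fun x y z hxyz => h _ _ _ (hxyz.cons a)⟩

/-- Take e < r < d with r in R and d, e in D, and a 231 `x y z` in R. The dip condition at e forces
x < e < r. If x preceded r, then r would be an ascent top below d. So x follows r, and `r y z` is a
231 with middle letter above e, a contradiction. -/
theorem mem_slopePairs_of_hasMid {w : List ℕ × List ℕ} (hw : w ∈ weakSlopePairs)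
    (hm : HasMid w) : w ∈ slopePairs := by
  obtain ⟨D, R⟩ := w
  obtain ⟨-, hs, hD, h⟩ := hw
  refine ⟨hs, hD, ?_, fun d hd => (h d hd).1⟩
  obtain ⟨r, hr, d, hd, e, he, h1, h2⟩ := hm
  simp only at hs hD h hr hd he
  refine triplewise_iff_forall_sublist.2 fun x y z hxyz _ hxy => ?_
  by_contra! hzx
  have hasc : ∀ d ∈ D, ∀ u v, [u, v].Sublist R → u < v → d ≤ v := fun d hd u v huv =>
    List.pairwise_iff_forall_sublist.1 (h d hd).1 huv
  have hdip : ∀ d ∈ D, ∀ u v w, [u, v, w].Sublist R → d ≤ u → u < v → u ≤ w :=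
    fun d hd => triplewise_iff_forall_sublist.1 (h d hd).2
  have hxe : x < e := by
    by_contra! hex
    have := hdip e he x y z hxyz hex hxy
    lia
  have hxR : x ∈ R := hxyz.subset (by simp)
  obtain ⟨R₁, R₂, rfl⟩ := List.append_of_mem hr
  have hx2 : x ∉ R₁ := fun hx => by
    have := hasc d hd x r ?_ (by lia)
    · lia
    · exact (List.singleton_sublist.2 hx).append (List.singleton_sublist.2 (by simp))
  have hyz : [x, y, z].Sublist R₂ := by
    rcases List.sublist_append_iff.1 hxyz with ⟨l₁, l₂, h3, h4, h5⟩
    rcases l₁ with _ | ⟨a, l₁⟩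
    · rw [List.nil_append] at h3
      subst h3
      rcases List.cons_sublist_cons'.1 h5 with h | ⟨rfl, h⟩
      · exact h
      · lia
    · simp only [List.cons_append, List.cons.injEq] at h3
      exact absurd (h4.subset (by simp [h3.1])) hx2
  have h3 : [r, y, z].Sublist (R₁ ++ r :: R₂) :=
    ((((List.sublist_cons_self x _).trans hyz).cons_cons r).trans (List.sublist_append_right _ _))
  have := hasc d hd x y ((List.Sublist.cons_cons x (by simp)).trans hxyz) hxy
  have := hdip e he r y z h3 (by lia) (by lia)
  lia

theorem weakSlopePairs_inter_hasMid :
    weakSlopePairs ∩ {w | HasMid w} = slopePairs ∩ {w | HasMid w} := by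
  ext w
  constructor
  · exact fun h => ⟨mem_slopePairs_of_hasMid h.1 h.2, h.2⟩
  · rintro ⟨⟨h1, h2, h3, h4⟩, h5⟩
    refine ⟨⟨?_, h1, h2, fun d hd => ⟨h4 d hd, h3.mono (Nat.zero_le d)⟩⟩, h5⟩
    obtain ⟨r, hr, d, hd, -⟩ := h5
    exact List.ne_nil_of_mem hd

/-! #### Pairs whose first word consists of consecutive values -/

/-- The decreasing word `p + k - 1, …, p` and the word `R` with its letters from `p` on raised. -/
def intervalPair (w : ℕ × ℕ × List ℕ) : List ℕ × List ℕ :=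
  ((List.range' w.2.1 w.1).reverse, w.2.2.map (raise w.2.1 w.1))

theorem pairwise_gt_reverse_range' (p k : ℕ) : (List.range' p k).reverse.Pairwise (· > ·) := by
  rw [List.pairwise_reverse]
  exact List.pairwise_lt_range'

/-- No raised letter falls in the interval of values of the first word, so the conditions for all
its letters d coincide and reduce to the single threshold `p`. -/
theorem mem_weakSlopePairs_intervalPair {p k : ℕ} {R : List ℕ} (hk : k ≠ 0) (hp : p ≤ R.length) :
    intervalPair (k, p, R) ∈ weakSlopePairs ↔ (p, R) ∈ thresholdWords := by
  have h1 : ∀ d ∈ (List.range' p k).reverse, AscGe d (R.map (raise p k)) ↔ AscGe p R := by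
    intro d hd
    rw [List.mem_reverse, List.mem_range'_1] at hd
    rw [AscGe, AscGe, List.pairwise_map]
    constructor <;> refine fun h => h.imp ?_ <;> grind [raise]
  have h2 : ∀ d ∈ (List.range' p k).reverse, NoDip d (R.map (raise p k)) ↔ NoDip p R := by
    intro d hd
    rw [List.mem_reverse, List.mem_range'_1] at hd
    rw [NoDip, NoDip, List.triplewise_map]
    constructor <;> refine fun h => h.imp ?_ <;> grind [raise]
  have h3 : Std ((List.range' p k).reverse ++ R.map (raise p k)) ↔ Std R :=
    std_append_raise_iff (nodup_of_pairwise_gt (pairwise_gt_reverse_range' p k))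
      (by simp [List.mem_range'_1]) hp
  have hpm : p ∈ (List.range' p k).reverse := by
    rw [List.mem_reverse, List.mem_range'_1]
    lia
  simp only [weakSlopePairs, intervalPair, thresholdWords, Set.mem_ofPred_eq, h3]
  constructor
  · exact fun h => ⟨h.2.1, hp, (h1 p hpm).1 (h.2.2.2 p hpm).1, (h2 p hpm).1 (h.2.2.2 p hpm).2⟩
  · exact fun h => ⟨List.ne_nil_of_mem hpm, h.1, pairwise_gt_reverse_range' p k,
      fun d hd => ⟨(h1 d hd).2 h.2.2.1, (h2 d hd).2 h.2.2.2⟩⟩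

theorem mem_slopePairs_intervalPair {k : ℕ} {R : List ℕ} :
    intervalPair (k, 0, R) ∈ slopePairs ↔ R ∈ catWords := by
  have hr : R.map (raise 0 k) = R.map (· + k) := by simp [raise]
  have h3 : Std ((List.range' 0 k).reverse ++ R.map (raise 0 k)) ↔ Std R :=
    std_append_raise_iff (nodup_of_pairwise_gt (pairwise_gt_reverse_range' 0 k))
      (by simp [List.mem_range'_1]) (Nat.zero_le _)
  have h4 : ∀ d ∈ (List.range' 0 k).reverse, AscGe d (R.map (· + k)) := by
    intro d hd
    rw [List.mem_reverse, List.mem_range'_1] at hd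
    rw [AscGe, List.pairwise_map]
    exact List.pairwise_of_forall (by grind)
  rw [hr] at h3
  simp only [slopePairs, intervalPair, catWords, Set.mem_ofPred_eq, hr, h3,
    noDip_map_add (Nat.zero_le k)]
  exact ⟨fun h => ⟨h.1, h.2.2.1⟩, fun h => ⟨h.1, pairwise_gt_reverse_range' 0 k, h.2, h4⟩⟩

theorem length_intervalPair (w : ℕ × ℕ × List ℕ) :
    (intervalPair w).1.length + (intervalPair w).2.length = w.1 + w.2.2.length := by
  simp [intervalPair]

theorem exists_intervalPair_eq {D R : List ℕ} (hs : Std (D ++ R)) (hD : D.Pairwise (· > ·))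
    {p k : ℕ} (h : ∀ x, x ∈ D ↔ p ≤ x ∧ x < p + k) (hk : k ≠ 0 ∨ p = 0) :
    ∃ R', (D, R) = intervalPair (k, p, R') ∧ p ≤ R'.length := by
  have hDe : D = (List.range' p k).reverse :=
    eq_of_pairwise_gt hD (pairwise_gt_reverse_range' p k) (by simpa [List.mem_range'_1] using h)
  have hR : ∀ x ∈ R, x < p ∨ p + k ≤ x := by
    intro x hx
    have : x ∉ D := fun hx' => (List.nodup_append.1 hs.1).2.2 x hx' x hx rfl
    rw [h] at this
    lia
  obtain ⟨R', rfl⟩ := exists_map_raise_eq hR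
  refine ⟨R', by rw [hDe]; rfl, ?_⟩
  rcases hk with hk | rfl
  · have h1 := (hs.2 (p + k - 1)).1 (by rw [List.mem_append, h]; left; lia)
    simp [hDe] at h1
    lia
  · exact Nat.zero_le _

theorem not_hasLow_intervalPair {k : ℕ} {R : List ℕ} : ¬ HasLow (intervalPair (k, 0, R)) := by
  simp only [HasLow, intervalPair, List.mem_map, List.mem_reverse, List.mem_range'_1, raise]
  grind

theorem not_hasMid_intervalPair {w : ℕ × ℕ × List ℕ} : ¬ HasMid (intervalPair w) := by
  simp only [HasMid, intervalPair, List.mem_map, List.mem_reverse, List.mem_range'_1, raise]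
  grind

theorem slopePairs_diff_hasLow :
    slopePairs ∩ {w | ¬ HasLow w} =
      (fun w : ℕ × List ℕ => intervalPair (w.1, 0, w.2)) '' (Set.univ ×ˢ catWords) := by
  ext ⟨D, R⟩
  constructor
  · rintro ⟨hw, hl⟩
    obtain ⟨hs, hD, -⟩ := id hw
    -- The head of `D` is its maximum, and no smaller value is left to `R`.
    obtain ⟨k, hk⟩ : ∃ k, ∀ x, x ∈ D ↔ 0 ≤ x ∧ x < 0 + k := by
      rcases D with _ | ⟨m, D⟩
      · exact ⟨0, by simp⟩
      · refine ⟨m + 1, fun x => ?_⟩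
        rw [List.pairwise_cons] at hD
        have h1 := (hs.2 m).1 (by simp)
        have h2 := hs.2 x
        have h3 : x ∈ R → ¬ x < m := fun hx hxm => hl ⟨x, hx, m, by simp, hxm⟩
        have h4 := hs.1
        grind
    obtain ⟨R', he, -⟩ := exists_intervalPair_eq hs hD hk (Or.inr rfl)
    rw [he] at hw
    exact ⟨(k, R'), ⟨trivial, mem_slopePairs_intervalPair.1 hw⟩, he.symm⟩
  · rintro ⟨⟨k, R'⟩, ⟨-, h⟩, he⟩
    rw [← he]
    exact ⟨mem_slopePairs_intervalPair.2 h, not_hasLow_intervalPair⟩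

theorem weakSlopePairs_diff_hasMid :
    weakSlopePairs ∩ {w | ¬ HasMid w} =
      (fun w : ℕ × ℕ × List ℕ => intervalPair (w.1 + 1, w.2)) '' (Set.univ ×ˢ thresholdWords) := by
  ext ⟨D, R⟩
  constructor
  · rintro ⟨hw, hl⟩
    obtain ⟨hne, hs, hD, -⟩ := id hw
    simp only at hne hs hD
    obtain ⟨p, hp, hmin⟩ := D.toFinset.exists_min_image id (by simpa using hne)
    obtain ⟨m, hm, hmax⟩ := D.toFinset.exists_max_image id (by simpa using hne)
    simp only [List.mem_toFinset, id] at hp hmin hm hmax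
    obtain ⟨k, rfl⟩ := Nat.exists_eq_add_of_le (hmin m hm)
    have hk : ∀ x, x ∈ D ↔ p ≤ x ∧ x < p + (k + 1) := by
      refine fun x => ⟨fun hx => ⟨hmin x hx, by have := hmax x hx; lia⟩, fun hx => ?_⟩
      have h1 := (hs.2 (p + k)).1 (by simp [hm])
      have h2 := (hs.2 x).2 (by lia)
      have h3 : x ∈ R → ¬ (p < x ∧ x < p + k) := fun hx h => hl ⟨x, hx, _, hm, _, hp, h⟩
      grind
    obtain ⟨R', he, hl⟩ := exists_intervalPair_eq hs hD hk (Or.inl (by lia))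
    rw [he] at hw
    exact ⟨(k, p, R'), ⟨trivial, (mem_weakSlopePairs_intervalPair (by lia) hl).1 hw⟩, he.symm⟩
  · rintro ⟨⟨k, p, R'⟩, ⟨-, h⟩, he⟩
    rw [← he]
    exact ⟨(mem_weakSlopePairs_intervalPair (by lia) h.2.1).2 h, not_hasMid_intervalPair⟩

/-- An empty interval forgets its position `p`, so that position is fixed to be 0. -/
theorem intervalPair_injOn : Set.InjOn intervalPair {w | w.1 ≠ 0 ∨ w.2.1 = 0} := by
  rintro ⟨k, p, R⟩ hw ⟨k', p', R'⟩ hw' h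
  simp only [intervalPair, Prod.mk.injEq, List.reverse_inj] at h
  obtain ⟨h1, h2⟩ := h
  have hk : k = k' := by simpa using congrArg List.length h1
  subst hk
  have hp : p = p' := by
    rcases k with _ | k
    · simp at hw hw'
      rw [hw, hw']
    · simpa [List.range'_succ] using (List.cons.inj h1).1
  subst hp
  rw [map_raise_injective _ _ h2]

/-! #### Pairs with a letter of the second word below a letter of the first word -/

/-- The `231`-avoiding words, split at the letter `0`. -/
def splitCatWords : Set (List ℕ × List ℕ) := {w | w.1 ++ 0 :: w.2 ∈ catWords}

/-- The nonempty subsets `S` of `{0, …, m - 1}`, as pairs `(m, S)`. -/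
def lowSets : Set (ℕ × Finset ℕ) := {s | s.2 ⊆ Finset.range s.1 ∧ s.2.Nonempty}

/-- The sets in `lowSets` that are not initial segments. -/
def midSets : Set (ℕ × Finset ℕ) :=
  {s | s.2 ⊆ Finset.range s.1 ∧ ∃ r ∈ s.2, ∃ d ∉ s.2, d < r}

/-- The pair that has the letters of `S` in the second word in place of the letter `0` of
`α ++ 0 :: β`, and `m` and the smaller letters that are not in `S` in the first word. -/
def blockPair (w : (ℕ × Finset ℕ) × (List ℕ × List ℕ)) : List ℕ × List ℕ :=
  (w.1.1 :: (Finset.range w.1.1 \ w.1.2).sort (· ≥ ·),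
    w.2.1.map (· + w.1.1) ++ (w.1.2.sort (· ≥ ·) ++ w.2.2.map (· + w.1.1)))

theorem pairwise_gt_sort (S : Finset ℕ) : (S.sort (· ≥ ·)).Pairwise (· > ·) :=
  S.sortedGT_sort.pairwise

/-- The letter 0 completes a 231 with any ascent before it. Once `α` has no ascent, only triples
with their last two letters in `β` matter. -/
theorem noDip_zero_cons_iff {α β : List ℕ} (hα : ∀ x ∈ α, 0 < x) :
    NoDip 0 (α ++ 0 :: β) ↔ α.Pairwise (fun x y => y ≤ x) ∧ NoDip 0 β ∧
      ∀ x ∈ α, β.Pairwise fun y z => x < y → x ≤ z := by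
  simp only [NoDip, List.triplewise_append, List.triplewise_cons, List.pairwise_cons,
    List.forall_mem_cons, zero_le, forall_const]
  constructor
  · rintro ⟨h1, ⟨h2, h3⟩, h4, h5, h6⟩
    exact ⟨h5.imp_of_mem fun {x y} hx _ h => by have := hα x hx; grind, h3, fun x hx => (h4 x hx).2⟩
  · rintro ⟨h1, h2, h3⟩
    refine ⟨?_, ⟨List.pairwise_of_forall (by simp), h2⟩,
      fun x hx => ⟨by grind, h3 x hx⟩, h1.imp (by grind), fun z _ => h1.imp (by grind)⟩
    clear h3 hα
    induction α with
    | nil => exact .nil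
    | cons a α ih =>
      rw [List.pairwise_cons] at h1
      exact .cons (List.pairwise_of_forall_mem_list (by grind)) (ih h1.2)

/-- A nonempty decreasing block below all other letters constrains them exactly as a single letter 0
does: no ascent may precede it. -/
theorem noDip_block_iff {m : ℕ} {α β ρ : List ℕ} (hα : ∀ x ∈ α, 0 < x)
    (hρ : ρ.Pairwise (· > ·)) (hρm : ∀ x ∈ ρ, x < m) (hne : ρ ≠ []) :
    NoDip 0 (α.map (· + m) ++ (ρ ++ β.map (· + m))) ↔ NoDip 0 (α ++ 0 :: β) := by
  have hρd : ρ.Triplewise fun x y z => 0 ≤ x → x < y → x ≤ z := by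
    clear hρm hne
    induction ρ with
    | nil => exact .nil
    | cons a ρ ih =>
      rw [List.pairwise_cons] at hρ
      exact .cons (List.pairwise_of_forall_mem_list (by grind)) (ih hρ.2)
  obtain ⟨r, hr⟩ := List.exists_mem_of_ne_nil ρ hne
  rw [noDip_zero_cons_iff hα, ← noDip_map_add (R := β) (Nat.zero_le m)]
  constructor
  · intro h
    rw [NoDip, List.triplewise_append, List.triplewise_append] at h
    obtain ⟨h1, ⟨-, h2, -, -⟩, h3, h4⟩ := h
    refine ⟨?_, h2, fun x hx => ?_⟩
    · have := List.pairwise_map.1 (h4 r (by simp [hr]))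
      refine this.imp fun {x y} h => ?_
      have := hρm r hr
      grind
    · have := h3 (x + m) (List.mem_map_of_mem hx)
      rw [List.pairwise_append, List.pairwise_map] at this
      exact this.2.1.imp (by grind)
  · rintro ⟨h1, h2, h3⟩
    have h4 : (α.map (· + m)).Pairwise fun x y => y ≤ x := by
      rw [List.pairwise_map]
      exact h1.imp (by grind)
    rw [NoDip, List.triplewise_append, List.triplewise_append]
    refine ⟨?_, ⟨hρd, h2, ?_, ?_⟩, ?_, ?_⟩
    · rw [List.triplewise_map]
      exact ((noDip_zero_cons_iff (β := []) hα).2 ⟨h1, .nil, by simp⟩ |>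
        List.triplewise_append.1).1.imp (by grind)
    · exact fun x hx => List.pairwise_of_forall_mem_list (by grind)
    · exact fun z hz => hρ.imp (by grind)
    · intro x hx
      obtain ⟨u, hu, rfl⟩ := List.mem_map.1 hx
      rw [List.pairwise_append, List.pairwise_map]
      exact ⟨List.pairwise_of_forall_mem_list (by grind), (h3 u hu).imp (by grind), by grind⟩
    · exact fun z hz => h4.imp (by grind)

theorem pos_of_split {w : List ℕ × List ℕ} (hw : w ∈ splitCatWords) :
    (∀ x ∈ w.1, 0 < x) ∧ ∀ x ∈ w.2, 0 < x := by
  have := hw.1.1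
  grind

/-- The set and its complement contribute `m` letters and the letter `m` one more; the collapsed
letter 0 is not counted. -/
theorem length_blockPair {w : (ℕ × Finset ℕ) × (List ℕ × List ℕ)}
    (hS : w.1.2 ⊆ Finset.range w.1.1) :
    (blockPair w).1.length + (blockPair w).2.length =
      w.1.1 + (w.2.1.length + w.2.2.length) + 1 := by
  have h1 := Finset.card_sdiff_of_subset hS
  have h2 := Finset.card_le_card hS
  rw [Finset.card_range] at h1 h2
  simp only [blockPair, List.length_cons, List.length_append, List.length_map, Finset.length_sort, h1]
  lia

theorem blockPair_mem_slopePairs {w : (ℕ × Finset ℕ) × (List ℕ × List ℕ)}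
    (hS : w.1 ∈ lowSets) (hw : w.2 ∈ splitCatWords) : blockPair w ∈ slopePairs := by
  have hlen := length_blockPair hS.1
  obtain ⟨hα, hβ⟩ := pos_of_split hw
  obtain ⟨⟨m, S⟩, α, β⟩ := w
  obtain ⟨hS, hne⟩ := hS
  obtain ⟨⟨hnd, hlt⟩, hdip⟩ := hw
  simp only at hS hne hnd hlt hdip hα hβ
  have hSm : ∀ x ∈ S.sort (· ≥ ·), x < m := fun x hx => by simpa using hS ((Finset.mem_sort _).1 hx)
  have hSne : S.sort (· ≥ ·) ≠ [] := by
    obtain ⟨r, hr⟩ := hne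
    exact List.ne_nil_of_mem ((Finset.mem_sort _).2 hr)
  have hD : (blockPair ((m, S), α, β)).1.Pairwise (· > ·) :=
    List.pairwise_cons.2 ⟨fun x hx => by simp at hx; lia, pairwise_gt_sort _⟩
  refine ⟨std_of_lt ?_ ?_, hD, (noDip_block_iff hα (pairwise_gt_sort S) hSm hSne).2 hdip, ?_⟩
  · refine List.nodup_append'.2 ⟨nodup_of_pairwise_gt hD, ?_, ?_⟩
    · have h1 : α.Nodup := by grind
      have h2 : β.Nodup := by grind
      have h3 := h1.map (add_left_injective m)
      have h4 := h2.map (add_left_injective m)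
      have h5 := S.sort_nodup (· ≥ ·)
      simp only [blockPair, List.nodup_append]
      refine ⟨h3, ⟨h5, h4, ?_⟩, ?_⟩
      · grind
      · grind
    · intro x hx hx'
      simp only [blockPair, List.mem_cons, Finset.mem_sort, Finset.mem_sdiff, Finset.mem_range,
        List.mem_append, List.mem_map] at hx hx'
      grind
  · intro x hx
    rw [List.length_append, hlen]
    simp only [blockPair, List.mem_cons, Finset.mem_sort, Finset.mem_sdiff, Finset.mem_range,
      List.mem_append, List.mem_map] at hx
    have h1 : ∀ x ∈ α, x < α.length + β.length + 1 := fun x hx => by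
      have := (hlt x).1 (by simp [hx]); simpa [add_assoc] using this
    have h2 : ∀ x ∈ β, x < α.length + β.length + 1 := fun x hx => by
      have := (hlt x).1 (by simp [hx]); simpa [add_assoc] using this
    simp only [Finset.mem_sort] at hSm
    grind
  · intro d hd
    have hdm : d ≤ m := by
      simp only [blockPair, List.mem_cons, Finset.mem_sort, Finset.mem_sdiff, Finset.mem_range] at hd
      lia
    refine AscGe.mono ?_ hdm
    simp only [AscGe, blockPair, List.pairwise_append, List.pairwise_map]
    refine ⟨List.pairwise_of_forall (by grind), ⟨(pairwise_gt_sort S).imp (by grind),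
      List.pairwise_of_forall (by grind), by grind⟩, by grind⟩

theorem hasLow_blockPair {w : (ℕ × Finset ℕ) × (List ℕ × List ℕ)}
    (hS : w.1 ∈ lowSets) : HasLow (blockPair w) := by
  obtain ⟨r, hr⟩ := hS.2
  exact ⟨r, by simp [blockPair, hr], w.1.1, by simp [blockPair], by simpa using hS.1 hr⟩

theorem hasMid_blockPair_iff {w : (ℕ × Finset ℕ) × (List ℕ × List ℕ)}
    (hS : w.1 ∈ lowSets) : HasMid (blockPair w) ↔ w.1 ∈ midSets := by
  obtain ⟨⟨m, S⟩, α, β⟩ := w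
  have hS' : ∀ x ∈ S, x < m := fun x hx => by simpa using hS.1 hx
  constructor
  · rintro ⟨r, hr, d, hd, e, he, h1, h2⟩
    refine ⟨hS.1, r, ?_, e, ?_, h1⟩ <;>
    · simp only [blockPair, List.mem_cons, Finset.mem_sort, Finset.mem_sdiff, Finset.mem_range,
        List.mem_append, List.mem_map] at hr hd he ⊢
      grind
  · rintro ⟨-, r, hr, e, he, h⟩
    have := hS' r hr
    refine ⟨r, by simp [blockPair, hr], m, by simp [blockPair], e, ?_, h, this⟩
    simp [blockPair]
    grind

/-- Let r be the first letter of R below m = max D. If a later y ≥ m were followed by z < m, then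
either z < r and `r y z` is a 231, or r < z is an ascent with top below m. So the letters below m
are consecutive, and they decrease because ascent tops are at least m. -/
theorem exists_block_split {D R : List ℕ} (hw : (D, R) ∈ slopePairs) (hl : HasLow (D, R)) :
    ∃ m D' α ρ β, D = m :: D' ∧ R = α ++ (ρ ++ β) ∧ ρ ≠ [] ∧ ρ.Pairwise (· > ·) ∧
      (∀ x ∈ ρ, x < m) ∧ (∀ x ∈ α, m ≤ x) ∧ ∀ x ∈ β, m ≤ x := by
  obtain ⟨hs, hD, hdip, hasc⟩ := hw
  obtain ⟨r, hr, d, hd, hrd⟩ := hl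
  rcases D with _ | ⟨m, D⟩
  · simp at hd
  simp only [List.pairwise_cons] at hD
  have hrm : r < m := by simp at hd; grind
  simp only at hs hdip hasc hr
  replace hasc := hasc m (by simp)
  have hRnd := (List.nodup_append.1 hs.1).2.1
  clear hs hd hrd
  obtain ⟨α, t, hRt, hα, r₁, t', rfl, hr₁⟩ :
      ∃ α t, R = α ++ t ∧ (∀ x ∈ α, m ≤ x) ∧ ∃ r t', t = r :: t' ∧ r < m := by
    clear hdip hasc hRnd
    induction R with
    | nil => simp at hr
    | cons a R ih =>
      by_cases ham : a < m
      · exact ⟨[], a :: R, by simp, by simp, a, R, rfl, ham⟩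
      · obtain ⟨α, t, rfl, h1, h2⟩ := ih (by grind)
        exact ⟨a :: α, t, by simp, by grind, h2⟩
  subst hRt
  rw [AscGe, List.pairwise_append, List.pairwise_cons] at hasc
  rw [NoDip, List.triplewise_append, List.triplewise_cons] at hdip
  replace hRnd := (List.nodup_append.1 hRnd).2.1
  obtain ⟨ρ, β, rfl, hρ, hβ⟩ := exists_append_of_pairwise (P := fun y => m ≤ y) (t := t') (by
    refine hdip.2.1.1.imp_of_mem fun {y z} hy hz h => ?_
    have h2 := hasc.2.1.1 z hz
    grind)
  refine ⟨m, D, α, r₁ :: ρ, β, rfl, by simp, by simp, ?_, by grind, hα, hβ⟩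
  have h1 : (r₁ :: ρ).Pairwise fun x y => x < y → m ≤ y :=
    (List.pairwise_cons.2 hasc.2.1).sublist (by simp)
  have h2 : (r₁ :: ρ).Nodup := hRnd.sublist (by simp)
  refine (h1.and h2).imp_of_mem fun {x y} hx hy h => ?_
  grind

theorem exists_blockPair_eq {w : List ℕ × List ℕ} (hw : w ∈ slopePairs) (hl : HasLow w) :
    ∃ s ∈ lowSets, ∃ v ∈ splitCatWords, blockPair (s, v) = w := by
  obtain ⟨D, R⟩ := w
  obtain ⟨m, D, α, ρ, β, rfl, rfl, hne, hρ, hρm, hα, hβ⟩ := exists_block_split hw hl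
  obtain ⟨hs, hD, hdip, -⟩ := hw
  simp only [List.pairwise_cons] at hs hD hdip
  have hnd := hs.1
  simp only [List.cons_append, List.nodup_cons, List.mem_append, not_or, List.nodup_append'] at hnd
  obtain ⟨⟨hmD, hmα, hmρ, hmβ⟩, hDn, ⟨hαn, ⟨hρn, hβn, hρβ⟩, hαρβ⟩, hDαρβ⟩ := hnd
  have hαβ : α.Disjoint β := fun x h1 h2 => hαρβ h1 (List.mem_append_right _ h2)
  have hDρ : D.Disjoint ρ := fun x h1 h2 =>
    hDαρβ h1 (List.mem_append_right _ (List.mem_append_left _ h2))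
  clear hαρβ hDαρβ hρβ
  -- The block and the tail of the first word partition the values below `m`; being decreasing, both
  -- are recovered from the set of letters of `ρ`.
  have hlow : ∀ x, x ∈ D ++ ρ ↔ x < m := by
    intro x
    have h1 := (hs.2 m).1 (by simp)
    have h2 := hs.2 x
    simp only [List.mem_append, List.mem_cons] at h2 ⊢
    constructor
    · rintro (h | h)
      · exact hD.1 x h
      · exact hρm x h
    · intro h
      rcases h2.2 (by lia) with (rfl | h') | h' | h' | h'
      · lia
      · exact Or.inl h'
      · exact absurd (hα x h') (by lia)
      · exact Or.inr h'
      · exact absurd (hβ x h') (by lia)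
  have hlen := (std_of_mem (l := D ++ ρ) (List.nodup_append'.2 ⟨hDn, hρn, hDρ⟩) hlow).2
  obtain ⟨α, rfl⟩ := exists_map_add_eq hα
  obtain ⟨β, rfl⟩ := exists_map_add_eq hβ
  have hα0 : ∀ x ∈ α, 0 < x := fun x hx =>
    Nat.pos_of_ne_zero fun h => hmα (by simpa using h ▸ hx)
  have hβ0 : ∀ x ∈ β, 0 < x := fun x hx =>
    Nat.pos_of_ne_zero fun h => hmβ (by simpa using h ▸ hx)
  have hSρ : ρ.toFinset.sort (· ≥ ·) = ρ := eq_of_pairwise_gt (pairwise_gt_sort _) hρ (by simp)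
  have hSD : (Finset.range m \ ρ.toFinset).sort (· ≥ ·) = D := by
    refine eq_of_pairwise_gt (pairwise_gt_sort _) hD.2 fun x => ?_
    rw [Finset.mem_sort, Finset.mem_sdiff, Finset.mem_range, List.mem_toFinset, ← hlow,
      List.mem_append]
    exact ⟨fun h => h.1.resolve_right h.2, fun h => ⟨Or.inl h, hDρ h⟩⟩
  refine ⟨(m, ρ.toFinset), ⟨fun x hx => ?_, List.toFinset_nonempty_iff _ |>.2 hne⟩, (α, β),
    ⟨std_of_lt ?_ ?_, ?_⟩, ?_⟩
  · rw [List.mem_toFinset] at hx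
    exact Finset.mem_range.2 (hρm x hx)
  · refine List.nodup_append'.2 ⟨hαn.of_map, List.nodup_cons.2 ⟨fun h => (hβ0 0 h).ne rfl,
      hβn.of_map⟩, ?_⟩
    intro x hx hx'
    rcases List.mem_cons.1 hx' with rfl | hx'
    · exact (hα0 0 hx).ne rfl
    · exact hαβ (List.mem_map_of_mem hx) (List.mem_map_of_mem hx')
  · intro x hx
    have hb : x = 0 ∨ x + m ∈ α.map (· + m) ∨ x + m ∈ β.map (· + m) := by
      simp at hx ⊢
      tauto
    rcases hb with rfl | hb
    · simp
    · have := (hs.2 (x + m)).1 (by simp only [List.mem_append, List.mem_cons]; tauto)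
      simp at this hlen ⊢
      lia
  · exact (noDip_block_iff hα0 hρ hρm hne).1 hdip
  · simp only [blockPair, hSρ, hSD]

theorem slopePairs_inter_hasLow :
    slopePairs ∩ {w | HasLow w} = blockPair '' (lowSets ×ˢ splitCatWords) := by
  ext w
  constructor
  · rintro ⟨hw, hl⟩
    obtain ⟨s, hs, v, hv, rfl⟩ := exists_blockPair_eq hw hl
    exact ⟨(s, v), ⟨hs, hv⟩, rfl⟩
  · rintro ⟨⟨s, v⟩, ⟨hs, hv⟩, rfl⟩
    exact ⟨blockPair_mem_slopePairs hs hv, hasLow_blockPair hs⟩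

theorem midSets_subset : midSets ⊆ lowSets := fun _ hs => ⟨hs.1, hs.2.imp fun _ h => h.1⟩

theorem slopePairs_inter_hasMid :
    slopePairs ∩ {w | HasMid w} = blockPair '' (midSets ×ˢ splitCatWords) := by
  ext w
  constructor
  · rintro ⟨hw, hm⟩
    have hl : HasLow w := by
      obtain ⟨r, hr, d, hd, e, he, h1, h2⟩ := hm
      exact ⟨r, hr, d, hd, h2⟩
    obtain ⟨s, hs, v, hv, rfl⟩ := exists_blockPair_eq hw hl
    exact ⟨(s, v), ⟨(hasMid_blockPair_iff hs).1 hm, hv⟩, rfl⟩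
  · rintro ⟨⟨s, v⟩, ⟨hs, hv⟩, rfl⟩
    have hs' := midSets_subset hs
    exact ⟨blockPair_mem_slopePairs hs' hv, (hasMid_blockPair_iff hs').2 hs⟩

/-- The first word reveals `m` and the complement of `S`; the block then starts at the first letter
of the second word below `m`. -/
theorem blockPair_injOn : Set.InjOn blockPair (lowSets ×ˢ splitCatWords) := by
  rintro ⟨⟨m, S⟩, α, β⟩ ⟨⟨hS, hne⟩, -⟩ ⟨⟨m', S'⟩, α', β'⟩ ⟨⟨hS', hne'⟩, -⟩ h
  simp only [blockPair, Prod.mk.injEq, List.cons.injEq] at h hS hS' hne hne'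
  obtain ⟨⟨rfl, h1⟩, h2⟩ := h
  have hSS : S = S' := by
    have := congrArg List.toFinset h1
    rw [Finset.sort_toFinset, Finset.sort_toFinset] at this
    rw [← Finset.sdiff_sdiff_eq_self hS, this, Finset.sdiff_sdiff_eq_self hS']
  subst hSS
  rcases hρ : S.sort (· ≥ ·) with _ | ⟨r, ρ⟩
  · obtain ⟨r, hr⟩ := hne
    rw [← Finset.mem_sort (· ≥ ·), hρ] at hr
    simp at hr
  · have hr : r < m := by
      have : r ∈ S := by
        rw [← Finset.mem_sort (· ≥ ·), hρ]
        simp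
      simpa using hS this
    rw [hρ] at h2
    obtain ⟨h3, -, h4⟩ := append_cons_inj (P := fun x => m ≤ x) (by simp) (by simp)
      (not_le.2 hr) (not_le.2 hr) h2
    rw [map_add_injective _ h3, map_add_injective _ (List.append_cancel_left h4)]

/-! #### Generating functions of the pairs -/

/-- The total length of a pair of words. -/
def pairLength (w : List ℕ × List ℕ) : ℕ := w.1.length + w.2.length

theorem splitCatWords_image : (fun w : List ℕ × List ℕ => w.1 ++ 0 :: w.2) '' splitCatWords =
    catWords \ {[]} := by
  ext l
  constructor
  · rintro ⟨w, hw, rfl⟩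
    exact ⟨hw, by simp⟩
  · rintro ⟨hl, hne⟩
    have h0 : 0 ∈ l := (hl.1.2 0).2 (List.length_pos_iff.2 hne)
    obtain ⟨α, β, rfl⟩ := List.append_of_mem h0
    exact ⟨(α, β), hl, rfl⟩

theorem splitCatWords_injOn :
    Set.InjOn (fun w : List ℕ × List ℕ => w.1 ++ 0 :: w.2) splitCatWords := by
  rintro ⟨α, β⟩ h ⟨α', β'⟩ h' he
  obtain ⟨rfl, -, rfl⟩ := append_cons_inj (P := fun x => 0 < x) (pos_of_split h).1
    (pos_of_split h').1 (by simp) (by simp) he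
  rfl

theorem gradedFinite_splitCatWords : GradedFinite pairLength splitCatWords := by
  intro n
  refine Set.Finite.of_finite_image (f := fun w : List ℕ × List ℕ => w.1 ++ 0 :: w.2)
    ((gradedFinite_catWords (n + 1)).subset ?_) (splitCatWords_injOn.mono fun _ h => h.1)
  rintro _ ⟨w, ⟨hw, rfl⟩, rfl⟩
  exact ⟨hw, by simp [pairLength, add_assoc]⟩

/-- `pairLength` omits the marked letter 0, whence the factor `X`. It is absorbed later by the extra
letter `m` of `blockPair`. -/
theorem gf_splitCatWords :
    X * gf pairLength splitCatWords = gf List.length catWords - 1 := by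
  have h1 := gf_image (size := pairLength) (size' := List.length) (k := 1) splitCatWords_injOn
    (fun w _ => by simp [pairLength, add_assoc])
  have h2 : catWords = {[]} ∪ (catWords \ {[]}) := by
    rw [Set.union_sdiff_cancel]
    rintro _ rfl
    exact ⟨std_nil, .nil⟩
  have h3 : gf List.length catWords = 1 + gf List.length (catWords \ {[]}) := by
    conv_lhs => rw [h2]
    rw [gf_union (gradedFinite_singleton _) (gradedFinite_catWords.mono Set.sdiff_subset)
      Set.disjoint_sdiff_right, gf_singleton]
    simp
  rw [splitCatWords_image, pow_one] at h1
  rw [← h1, h3]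
  ring

theorem gradedFinite_lowSets : GradedFinite Prod.fst lowSets := by
  intro m
  refine ((Set.finite_singleton m).prod (Finset.range m).powerset.finite_toSet).subset ?_
  rintro ⟨_, S⟩ ⟨h, rfl⟩
  exact ⟨rfl, Finset.mem_powerset.2 h.1⟩

theorem gf_lowSets : gf Prod.fst lowSets = PowerSeries.mk fun m => (2 : ℚ) ^ m - 1 := by
  ext m
  have h : {s | s ∈ lowSets ∧ s.1 = m} =
      Prod.mk m '' ((Finset.range m).powerset.erase ∅ : Set (Finset ℕ)) := by
    ext ⟨k, S⟩
    simp only [lowSets, Set.mem_ofPred_eq, Set.mem_image, Finset.mem_coe, Finset.mem_erase,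
      Finset.mem_powerset, Finset.nonempty_iff_ne_empty, Prod.mk.injEq]
    grind
  rw [gf, coeff_mk, coeff_mk, h, Set.ncard_image_of_injective _ (Prod.mk_right_injective m),
    Set.ncard_coe_finset, Finset.card_erase_of_mem (by simp), Finset.card_powerset,
    Finset.card_range, Nat.cast_sub Nat.one_le_two_pow]
  simp

theorem exists_range_eq {S : Finset ℕ} (h : ∀ r ∈ S, ∀ d, d < r → d ∈ S) :
    S = Finset.range S.card := by
  have : ∀ r ∈ S, r < S.card := by
    intro r hr
    have : Finset.range (r + 1) ⊆ S := fun d hd => by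
      rcases (Nat.lt_succ_iff_lt_or_eq.1 (Finset.mem_range.1 hd)) with hd | rfl
      · exact h r hr d hd
      · exact hr
    simpa using Finset.card_le_card this
  exact Finset.eq_of_subset_of_card_le (fun r hr => Finset.mem_range.2 (this r hr)) (by simp)

/-- The excluded subsets of {0, …, m-1} are its m + 1 initial segments, the empty one included. -/
theorem gf_midSets : gf Prod.fst midSets = PowerSeries.mk fun m => (2 : ℚ) ^ m - (m + 1) := by
  ext m
  have h : {s | s ∈ midSets ∧ s.1 = m} = Prod.mk m ''
      ((Finset.range m).powerset \ (Finset.range (m + 1)).image Finset.range :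
        Finset (Finset ℕ)) := by
    ext ⟨k, S⟩
    simp only [midSets, Set.mem_ofPred_eq, Set.mem_image, Finset.mem_coe, Finset.mem_sdiff,
      Finset.mem_powerset, Finset.mem_image, Finset.mem_range, Prod.mk.injEq, not_exists, not_and]
    constructor
    · rintro ⟨⟨h1, r, hr, d, hd, hdr⟩, rfl⟩
      refine ⟨S, ⟨h1, ?_⟩, rfl, rfl⟩
      rintro p - rfl
      rw [Finset.mem_range] at hr hd
      lia
    · rintro ⟨S', ⟨h1, h2⟩, rfl, rfl⟩
      refine ⟨⟨h1, ?_⟩, rfl⟩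
      by_contra! hc
      have hS := exists_range_eq (S := S') fun r hr d hd => by
        by_contra hd'
        exact absurd hd (not_lt.2 (hc r hr d hd'))
      have := Finset.card_le_card h1
      rw [Finset.card_range] at this
      exact h2 _ (by lia) hS.symm
  have hsub : (Finset.range (m + 1)).image Finset.range ⊆ (Finset.range m).powerset := by
    intro S hS
    obtain ⟨p, hp, rfl⟩ := Finset.mem_image.1 hS
    rw [Finset.mem_range] at hp
    exact Finset.mem_powerset.2 (Finset.range_subset_range.2 (by lia))
  have hinj : Function.Injective Finset.range := fun p q h => by
    simpa using congrArg Finset.card h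
  have hcard : ((Finset.range (m + 1)).image Finset.range).card = m + 1 := by
    rw [Finset.card_image_of_injective _ hinj, Finset.card_range]
  have hle := Finset.card_le_card hsub
  rw [gf, coeff_mk, coeff_mk, h, Set.ncard_image_of_injective _ (Prod.mk_right_injective m),
    Set.ncard_coe_finset, Finset.card_sdiff_of_subset hsub, Nat.cast_sub hle, hcard,
    Finset.card_powerset, Finset.card_range]
  push_cast
  ring

theorem gradedFinite_univ : GradedFinite id (Set.univ : Set ℕ) :=
  fun n => (Set.finite_singleton n).subset fun _ h => h.2

theorem gf_univ : gf id (Set.univ : Set ℕ) = PowerSeries.mk 1 := by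
  ext n
  have : {k : ℕ | k ∈ Set.univ ∧ id k = n} = {n} := by
    ext
    simp
  rw [gf, coeff_mk, coeff_mk, this, Set.ncard_singleton]
  simp

theorem gradedFinite_image_blockPair {s : Set (ℕ × Finset ℕ)} (hs : s ⊆ lowSets) :
    GradedFinite pairLength (blockPair '' (s ×ˢ splitCatWords)) :=
  ((gradedFinite_lowSets.mono hs).prod gradedFinite_splitCatWords).image (k := 1)
    fun _ hw => length_blockPair (hs hw.1).1

theorem gf_image_blockPair {s : Set (ℕ × Finset ℕ)} (hs : s ⊆ lowSets) :
    gf pairLength (blockPair '' (s ×ˢ splitCatWords)) =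
      gf Prod.fst s * (gf List.length catWords - 1) := by
  rw [gf_image (size := fun w : (ℕ × Finset ℕ) × (List ℕ × List ℕ) => w.1.1 + pairLength w.2)
    (k := 1) (blockPair_injOn.mono (Set.prod_mono_left hs))
    fun w hw => length_blockPair (hs hw.1).1,
    gf_prod (gradedFinite_lowSets.mono hs) gradedFinite_splitCatWords, ← gf_splitCatWords]
  ring

theorem slopePairs_eq : slopePairs =
    (fun w : ℕ × List ℕ => intervalPair (w.1, 0, w.2)) '' (Set.univ ×ˢ catWords) ∪
      blockPair '' (lowSets ×ˢ splitCatWords) := by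
  rw [← slopePairs_diff_hasLow, ← slopePairs_inter_hasLow, Set.union_comm]
  exact (Set.inter_union_compl slopePairs {w | HasLow w}).symm

theorem weakSlopePairs_eq : weakSlopePairs =
    (fun w : ℕ × ℕ × List ℕ => intervalPair (w.1 + 1, w.2)) '' (Set.univ ×ˢ thresholdWords) ∪
      blockPair '' (midSets ×ˢ splitCatWords) := by
  rw [← weakSlopePairs_diff_hasMid, ← slopePairs_inter_hasMid, ← weakSlopePairs_inter_hasMid,
    Set.union_comm]
  exact (Set.inter_union_compl weakSlopePairs {w | HasMid w}).symm

theorem gradedFinite_intervalPair_catWords : GradedFinite pairLength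
    ((fun w : ℕ × List ℕ => intervalPair (w.1, 0, w.2)) '' (Set.univ ×ˢ catWords)) :=
  (gradedFinite_univ.prod gradedFinite_catWords).image (k := 0) fun w _ =>
    length_intervalPair (w.1, 0, w.2)

theorem gradedFinite_intervalPair_thresholdWords : GradedFinite pairLength
    ((fun w : ℕ × ℕ × List ℕ => intervalPair (w.1 + 1, w.2)) ''
      (Set.univ ×ˢ thresholdWords)) :=
  (gradedFinite_univ.prod gradedFinite_thresholdWords).image (k := 1) fun w _ => by
    have := length_intervalPair (w.1 + 1, w.2)
    simp only [pairLength, id] at this ⊢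
    lia

theorem gradedFinite_slopePairs : GradedFinite pairLength slopePairs := by
  rw [slopePairs_eq]
  exact gradedFinite_intervalPair_catWords.union (gradedFinite_image_blockPair subset_rfl)

theorem gradedFinite_weakSlopePairs : GradedFinite pairLength weakSlopePairs := by
  rw [weakSlopePairs_eq]
  exact gradedFinite_intervalPair_thresholdWords.union (gradedFinite_image_blockPair midSets_subset)

theorem gf_slopePairs : gf pairLength slopePairs =
    PowerSeries.mk 1 * gf List.length catWords +
      (PowerSeries.mk fun m => (2 : ℚ) ^ m - 1) * (gf List.length catWords - 1) := by
  have h1 : Set.InjOn (fun w : ℕ × List ℕ => intervalPair (w.1, 0, w.2)) (Set.univ ×ˢ catWords) := by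
    rintro ⟨k, R⟩ - ⟨k', R'⟩ - h
    simpa using intervalPair_injOn (Or.inr rfl) (Or.inr rfl) h
  rw [slopePairs_eq, gf_union gradedFinite_intervalPair_catWords
    (gradedFinite_image_blockPair subset_rfl), gf_image_blockPair subset_rfl, gf_lowSets,
    gf_image (size := fun w : ℕ × List ℕ => id w.1 + w.2.length) (k := 0) h1
      fun w _ => length_intervalPair (w.1, 0, w.2),
    gf_prod gradedFinite_univ gradedFinite_catWords, gf_univ, pow_zero, one_mul]
  rw [← slopePairs_diff_hasLow, ← slopePairs_inter_hasLow]
  exact Set.disjoint_left.2 fun w h h' => h.2 h'.2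

theorem gf_weakSlopePairs : gf pairLength weakSlopePairs =
    X * (PowerSeries.mk 1 * gf (fun w : ℕ × List ℕ => w.2.length) thresholdWords) +
      (PowerSeries.mk fun m => (2 : ℚ) ^ m - (m + 1)) * (gf List.length catWords - 1) := by
  have h1 : Set.InjOn (fun w : ℕ × ℕ × List ℕ => intervalPair (w.1 + 1, w.2))
      (Set.univ ×ˢ thresholdWords) := by
    rintro ⟨k, p, R⟩ - ⟨k', p', R'⟩ - h
    simpa using intervalPair_injOn (Or.inl (Nat.succ_ne_zero _)) (Or.inl (Nat.succ_ne_zero _)) h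
  have h2 : ∀ w ∈ (Set.univ ×ˢ thresholdWords : Set (ℕ × ℕ × List ℕ)),
      pairLength (intervalPair (w.1 + 1, w.2)) = id w.1 + w.2.2.length + 1 := fun w _ => by
    have := length_intervalPair (w.1 + 1, w.2)
    simp only [pairLength, id] at this ⊢
    lia
  rw [weakSlopePairs_eq, gf_union gradedFinite_intervalPair_thresholdWords
    (gradedFinite_image_blockPair midSets_subset), gf_image_blockPair midSets_subset, gf_midSets,
    gf_image (size := fun w : ℕ × ℕ × List ℕ => id w.1 + w.2.2.length) (k := 1) h1 h2,
    gf_prod (size' := fun w : ℕ × List ℕ => w.2.length) gradedFinite_univ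
      gradedFinite_thresholdWords, gf_univ, pow_one]
  rw [← weakSlopePairs_diff_hasMid, ← slopePairs_inter_hasMid]
  exact Set.disjoint_left.2 fun w h h' => h.2 h'.2

/-! ### Decomposition of the avoiders at the largest letter -/

/-- The words avoiding `1342`, `2341`, `3412`. -/
def avoidWords : Set (List ℕ) := {l | Std l ∧ Avoid l}

/-- The nonempty words avoiding `1342`, `2341`, `3412` whose first letter is not the largest. -/
def coreWords : Set (List ℕ) := {l | l ∈ avoidWords ∧ l ≠ [] ∧ ∀ t, l ≠ t.length :: t}

/-- The word consisting of a pair of words, separated by a new largest letter. -/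
def joinMax (w : List ℕ × List ℕ) : List ℕ := w.1 ++ pairLength w :: w.2

/-- The word `D L n R`, where `n` is a new largest letter and `L` lies below the pair `(D, R)`. -/
def joinAbove (w : List ℕ × (List ℕ × List ℕ)) : List ℕ :=
  w.2.1.map (· + w.1.length) ++
    (w.1 ++ (w.1.length + pairLength w.2) :: w.2.2.map (· + w.1.length))

/-! ### Avoidance expressed through the pieces around the largest letter -/

theorem Avoid.sublist {l₁ l₂ : List ℕ} (h : Avoid l₂) (hs : l₁.Sublist l₂) : Avoid l₁ :=
  fun _ _ _ _ h' => h _ _ _ _ (h'.trans hs)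

theorem avoid_cons_iff {n : ℕ} {R : List ℕ} (hn : ∀ x ∈ R, x < n) : Avoid (n :: R) ↔ Avoid R := by
  refine ⟨fun h => h.sublist (List.sublist_cons_self _ _), fun h a b c e hs => ?_⟩
  rcases List.cons_sublist_cons'.1 hs with hs' | ⟨rfl, hs'⟩
  · exact h _ _ _ _ hs'
  · have := hn b (hs'.subset (by simp))
    lia

theorem sublist_append_cases {a b c e : ℕ} {A B : List ℕ} (h : [a, b, c, e].Sublist (A ++ B)) :
    [a, b, c, e].Sublist B ∨ (a ∈ A ∧ [b, c, e].Sublist B) ∨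
      ([a, b].Sublist A ∧ [c, e].Sublist B) ∨ ([a, b, c].Sublist A ∧ e ∈ B) ∨
      [a, b, c, e].Sublist A := by
  obtain ⟨l₁, l₂, h1, h2, h3⟩ := List.sublist_append_iff.1 h
  rcases l₁ with _ | ⟨x₁, _ | ⟨x₂, _ | ⟨x₃, _ | ⟨x₄, l₁⟩⟩⟩⟩ <;>
    simp only [List.nil_append, List.cons_append, List.cons.injEq] at h1
  · subst h1
    exact Or.inl h3
  · obtain ⟨rfl, rfl⟩ := h1
    exact Or.inr (Or.inl ⟨List.singleton_sublist.1 h2, h3⟩)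
  · obtain ⟨rfl, rfl, rfl⟩ := h1
    exact Or.inr (Or.inr (Or.inl ⟨h2, h3⟩))
  · obtain ⟨rfl, rfl, rfl, rfl⟩ := h1
    exact Or.inr (Or.inr (Or.inr (Or.inl ⟨h2, List.singleton_sublist.1 h3⟩)))
  · obtain ⟨rfl, rfl, rfl, rfl, h1⟩ := h1
    rw [List.nil_eq_append_iff] at h1
    rw [h1.1] at h2
    exact Or.inr (Or.inr (Or.inr (Or.inr h2)))

theorem ascGe_iff {p : ℕ} {l : List ℕ} : AscGe p l ↔ ∀ x y, [x, y].Sublist l → x < y → p ≤ y := by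
  rw [AscGe, List.pairwise_iff_forall_sublist]

theorem noDip_iff {q : ℕ} {l : List ℕ} :
    NoDip q l ↔ ∀ x y z, [x, y, z].Sublist l → q ≤ x → x < y → x ≤ z :=
  triplewise_iff_forall_sublist

theorem pairwise_gt_iff {l : List ℕ} : l.Pairwise (· > ·) ↔ ∀ x y, [x, y].Sublist l → y < x := by
  rw [List.pairwise_iff_forall_sublist]

/-- The conditions come from `d n x y` and `d x y z`. Conversely, every forbidden pattern starts
with an ascent, so at most its first letter lies in `D`. -/
theorem avoid_joinMax_iff {D R : List ℕ} {n : ℕ} (hne : D ≠ []) (hD : D.Pairwise (· > ·))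
    (hnd : (D ++ R).Nodup) (hDn : ∀ x ∈ D, x < n) (hRn : ∀ x ∈ R, x < n) :
    Avoid (D ++ n :: R) ↔ ∀ d ∈ D, AscGe d R ∧ NoDip d R := by
  simp only [ascGe_iff, noDip_iff]
  rw [pairwise_gt_iff] at hD
  constructor
  · intro h d hd
    have hd' := List.singleton_sublist.2 hd
    refine ⟨fun x y hxy hlt => ?_, fun x y z hxyz hdx hxy => ?_⟩
    · have := (h d n x y (hd'.append (hxy.cons_cons n))).2
      have := hDn d hd
      lia
    · have := (h d x y z (hd'.append (hxyz.cons n))).1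
      have : d ≠ x := (List.nodup_append.1 hnd).2.2 d hd x (hxyz.subset (by simp))
      lia
  · intro h a b c e hs
    suffices ¬ (a < b ∧ (b < c ∧ e < b ∨ c < e ∧ e < a)) by tauto
    rintro ⟨hab, hp⟩
    rcases sublist_append_cases hs with hs | ⟨ha, hs⟩ | ⟨hs, -⟩ | ⟨hs, -⟩ | hs
    · rcases List.cons_sublist_cons'.1 hs with hs | ⟨rfl, hs'⟩
      -- An occurrence inside `R` contains a 231, `b c e` or `a b e`; the ascent condition puts its
      -- middle letter at or above any chosen `d`.
      · obtain ⟨d, hd⟩ := List.exists_mem_of_ne_nil D hne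
        obtain ⟨h1, h2⟩ := h d hd
        have e1 := h1 a b (.trans (by simp) hs) hab
        have e2 := h1 c e (.trans (by simp) hs)
        have e3 := h2 b c e (.trans (by simp) hs)
        have e4 := h2 a b e (.trans (by simp) hs)
        lia
      · have := hRn b (hs'.subset (by simp))
        lia
    · obtain ⟨h1, h2⟩ := h a ha
      rcases List.cons_sublist_cons'.1 hs with hs | ⟨rfl, hs'⟩
      · have e2 := h1 c e (.trans (by simp) hs)
        have e3 := h2 b c e hs
        lia
      · have e2 := h1 c e hs'
        have := hRn c (hs'.subset (by simp))
        lia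
    all_goals
      have := hD a b (.trans (by simp) hs)
      lia

/-- A letter of `L` lies below all of `R`, so it extends every 231 in `R` to a forbidden pattern.
Conversely, an occurrence cannot join `L` to `n R` except through a 231 in `n R`, and one starting
in `D` skips `L`, since its second letter must be larger than its first. -/
theorem avoid_joinAbove_iff {D L R : List ℕ} {n m : ℕ} (hne : L ≠ []) (hD : D.Pairwise (· > ·))
    (hDn : ∀ x ∈ D, m ≤ x ∧ x < n) (hL : ∀ x ∈ L, x < m) (hRn : ∀ x ∈ R, m ≤ x ∧ x < n)
    (hmn : m ≤ n) :
    Avoid (D ++ (L ++ n :: R)) ↔ Avoid L ∧ NoDip 0 R ∧ ∀ d ∈ D, AscGe d R := by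
  simp only [ascGe_iff, noDip_iff]
  rw [pairwise_gt_iff] at hD
  constructor
  · intro h
    refine ⟨h.sublist ((List.sublist_append_left _ _).trans (List.sublist_append_right _ _)),
      fun x y z hxyz _ hxy => ?_, fun d hd x y hxy hlt => ?_⟩
    · obtain ⟨l, hl⟩ := List.exists_mem_of_ne_nil L hne
      have := (h l x y z (((List.singleton_sublist.2 hl).append (hxyz.cons n)).trans
        (List.sublist_append_right _ _))).1
      have := hL l hl
      have := hRn x (hxyz.subset (by simp))
      lia
    · have := (h d n x y ((List.singleton_sublist.2 hd).append
        ((hxy.cons_cons n).trans (List.sublist_append_right _ _)))).2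
      have := hDn d hd
      lia
  · rintro ⟨hLa, hdip, hasc⟩ a b c e hs
    suffices ¬ (a < b ∧ (b < c ∧ e < b ∨ c < e ∧ e < a)) by tauto
    rintro ⟨hab, hp⟩
    have hnR : ∀ x ∈ n :: R, m ≤ x ∧ x ≤ n := by
      intro x hx
      rcases List.mem_cons.1 hx with rfl | hx
      · exact ⟨hmn, le_rfl⟩
      · exact ⟨(hRn x hx).1, (hRn x hx).2.le⟩
    have key : ∀ b c e, [b, c, e].Sublist (n :: R) → ¬ (b < c ∧ e < b) := by
      rintro b c e hs hp
      rcases List.cons_sublist_cons'.1 hs with hs | ⟨rfl, hs'⟩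
      · have := hdip b c e hs
        lia
      · have := hRn c (hs'.subset (by simp))
        lia
    rcases sublist_append_cases hs with hs | ⟨ha, hs⟩ | ⟨hs, -⟩ | ⟨hs, -⟩ | hs
    · rcases sublist_append_cases hs with hs | ⟨ha, hs⟩ | ⟨hs, hs'⟩ | ⟨hs, he⟩ | hs
      · have e1 := key b c e (.trans (by simp) hs)
        have e2 := key a b e (.trans (by simp) hs)
        lia
      · have e1 := key b c e hs
        have e2 := hL a ha
        have e3 := hnR e (hs.subset (by simp))
        lia
      · have e1 := hL a (hs.subset (by simp))
        have e2 := hL b (hs.subset (by simp))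
        have e3 := hnR e (hs'.subset (by simp))
        lia
      · have e1 := hL a (hs.subset (by simp))
        have e2 := hL b (hs.subset (by simp))
        have e3 := hnR e he
        lia
      · have := hLa a b c e hs
        lia
    · have hb : b ∉ L := fun hb => by
        have := hL b hb
        have := hDn a ha
        lia
      have hs' : [b, c, e].Sublist (n :: R) := by
        obtain ⟨l₁, l₂, h1, h2, h3⟩ := List.sublist_append_iff.1 hs
        rcases l₁ with _ | ⟨x, l₁⟩
        · rw [List.nil_append] at h1
          rwa [h1]
        · simp only [List.cons_append, List.cons.injEq] at h1
          exact absurd (h2.subset (by simp [h1.1])) hb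
      have e1 := key b c e hs'
      have hce : [c, e].Sublist R := by
        rcases List.cons_sublist_cons'.1 hs' with h' | ⟨rfl, h'⟩
        · exact .trans (by simp) h'
        · exact h'
      have e2 := hasc a ha c e hce
      lia
    all_goals
      have := hD a b (.trans (by simp) hs)
      lia

/-! ### Letter sets and lengths of joined words -/

theorem std_joinMax_iff {D R : List ℕ} : Std (joinMax (D, R)) ↔ Std (D ++ R) := by
  have hp : (joinMax (D, R)).Perm ((D.length + R.length) :: (D ++ R)) := List.perm_middle
  have hlen : (joinMax (D, R)).length = D.length + R.length + 1 := by
    simp [joinMax, pairLength, add_assoc]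
  rw [Std, hp.nodup_iff, List.nodup_cons, hlen]
  simp only [hp.mem_iff, List.mem_cons]
  constructor
  · rintro ⟨⟨h1, h2⟩, h3⟩
    refine std_of_lt h2 fun x hx => ?_
    have := (h3 x).1 (Or.inr hx)
    have : x ≠ D.length + R.length := fun h => h1 (h ▸ hx)
    simp
    lia
  · rintro ⟨h1, h2⟩
    simp only [List.length_append] at h2
    refine ⟨⟨fun h => by simpa using (h2 _).1 h, h1⟩, fun x => ?_⟩
    rw [h2]
    lia

theorem std_add_iff {L W : List ℕ} (hL : ∀ x ∈ L, x < L.length) :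
    Std (L ++ W.map (· + L.length)) ↔ Std L ∧ Std W := by
  constructor
  · rintro ⟨h1, h2⟩
    obtain ⟨h3, h4, -⟩ := List.nodup_append.1 h1
    refine ⟨std_of_lt h3 hL, std_of_lt h4.of_map fun x hx => ?_⟩
    have := (h2 (x + L.length)).1 (List.mem_append_right _ (List.mem_map_of_mem hx))
    simp at this
    lia
  · rintro ⟨⟨h1, h2⟩, h3, h4⟩
    refine std_of_lt (List.nodup_append'.2 ⟨h1, h3.map (add_left_injective _), ?_⟩) ?_
    · intro x hx hx'
      obtain ⟨y, -, rfl⟩ := List.mem_map.1 hx'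
      have := (h2 _).1 hx
      lia
    · intro x hx
      simp only [List.length_append, List.length_map]
      rcases List.mem_append.1 hx with hx | hx
      · have := (h2 _).1 hx
        lia
      · obtain ⟨y, hy, rfl⟩ := List.mem_map.1 hx
        have := (h4 _).1 hy
        lia

theorem std_perm_iff {l₁ l₂ : List ℕ} (h : l₁.Perm l₂) : Std l₁ ↔ Std l₂ := by
  simp only [Std, h.nodup_iff, h.mem_iff, h.length_eq]

theorem std_joinAbove_iff {L D R : List ℕ} (hL : ∀ x ∈ L, x < L.length) :
    Std (joinAbove (L, D, R)) ↔ Std L ∧ Std (D ++ R) := by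
  rw [← std_joinMax_iff, ← std_add_iff hL]
  refine std_perm_iff ?_
  have h : (joinMax (D, R)).map (· + L.length) =
      D.map (· + L.length) ++ (L.length + pairLength (D, R)) :: R.map (· + L.length) := by
    simp [joinMax, add_comm]
  rw [h, joinAbove, ← List.append_assoc, ← List.append_assoc]
  exact List.perm_append_comm.append_right _

theorem length_joinMax (w : List ℕ × List ℕ) : (joinMax w).length = pairLength w + 1 := by
  simp [joinMax, pairLength, add_assoc]

theorem length_joinAbove (w : List ℕ × (List ℕ × List ℕ)) :
    (joinAbove w).length = w.1.length + pairLength w.2 + 1 := by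
  simp [joinAbove, pairLength]
  lia

theorem pairLength_lt {D R : List ℕ} (h : Std (D ++ R)) :
    (∀ x ∈ D, x < pairLength (D, R)) ∧ ∀ x ∈ R, x < pairLength (D, R) := by
  have := h.2
  simp only [List.length_append, List.mem_append] at this
  exact ⟨fun x hx => (this x).1 (Or.inl hx), fun x hx => (this x).1 (Or.inr hx)⟩

theorem joinMax_mem_avoidWords_iff {D R : List ℕ} (hne : D ≠ []) (hD : D.Pairwise (· > ·)) :
    joinMax (D, R) ∈ avoidWords ↔ (D, R) ∈ weakSlopePairs := by
  simp only [avoidWords, weakSlopePairs, Set.mem_ofPred_eq, std_joinMax_iff]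
  constructor
  · rintro ⟨h1, h2⟩
    obtain ⟨h3, h4⟩ := pairLength_lt h1
    exact ⟨hne, h1, hD, (avoid_joinMax_iff hne hD h1.1 h3 h4).1 h2⟩
  · rintro ⟨-, h1, -, h2⟩
    obtain ⟨h3, h4⟩ := pairLength_lt h1
    exact ⟨h1, (avoid_joinMax_iff hne hD h1.1 h3 h4).2 h2⟩

theorem joinAbove_mem_avoidWords_iff {L D R : List ℕ} (hne : L ≠ [])
    (hL : ∀ x ∈ L, x < L.length) (hD : D.Pairwise (· > ·)) :
    joinAbove (L, D, R) ∈ avoidWords ↔ L ∈ avoidWords ∧ (D, R) ∈ slopePairs := by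
  simp only [avoidWords, slopePairs, Set.mem_ofPred_eq, std_joinAbove_iff hL]
  have key : Std (D ++ R) → (Avoid (joinAbove (L, D, R)) ↔
      Avoid L ∧ NoDip 0 R ∧ ∀ d ∈ D, AscGe d R) := by
    intro h
    obtain ⟨h3, h4⟩ := pairLength_lt h
    rw [joinAbove, avoid_joinAbove_iff (m := L.length) hne ?_ ?_ hL ?_ (Nat.le_add_right _ _),
      noDip_map_add (Nat.zero_le _)]
    · refine and_congr_right fun _ => and_congr_right fun _ => ?_
      simp only [List.forall_mem_map, AscGe, List.pairwise_map, add_lt_add_iff_right,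
        add_le_add_iff_right]
    · rw [List.pairwise_map]
      exact hD.imp (by simp)
    · intro x hx
      obtain ⟨y, hy, rfl⟩ := List.mem_map.1 hx
      have := h3 y hy
      simp only
      lia
    · intro x hx
      obtain ⟨y, hy, rfl⟩ := List.mem_map.1 hx
      have := h4 y hy
      simp only
      lia
  constructor
  · rintro ⟨⟨h1, h2⟩, h3⟩
    obtain ⟨h4, h5, h6⟩ := (key h2).1 h3
    exact ⟨⟨h1, h4⟩, h2, hD, h5, h6⟩
  · rintro ⟨⟨h1, h4⟩, h2, -, h5, h6⟩
    exact ⟨⟨h1, h2⟩, (key h2).2 ⟨h4, h5, h6⟩⟩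

/-! ### The recursion for core words -/

theorem joinMax_mem_coreWords {w : List ℕ × List ℕ} (hw : w ∈ weakSlopePairs) :
    joinMax w ∈ coreWords := by
  obtain ⟨D, R⟩ := w
  refine ⟨(joinMax_mem_avoidWords_iff hw.1 hw.2.2.1).2 hw, by simp [joinMax], fun t ht => ?_⟩
  have hl := congrArg List.length ht
  rw [length_joinMax, List.length_cons, add_left_inj] at hl
  rcases D with _ | ⟨d, D⟩
  · exact hw.1 rfl
  · have := (pairLength_lt hw.2.1).1 d (by simp)
    have h2 : d = t.length := (List.cons.inj ht).1
    lia

theorem joinAbove_mem_coreWords {w : List ℕ × (List ℕ × List ℕ)} (hL : w.1 ∈ coreWords)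
    (hw : w.2 ∈ slopePairs) : joinAbove w ∈ coreWords := by
  obtain ⟨L, D, R⟩ := w
  obtain ⟨hL, hne, -⟩ := hL
  have hlt : ∀ x ∈ L, x < L.length := fun x hx => (hL.1.2 x).1 hx
  refine ⟨(joinAbove_mem_avoidWords_iff hne hlt hw.2.1).2 ⟨hL, hw⟩, by simp [joinAbove],
    fun t ht => ?_⟩
  have hl := congrArg List.length ht
  rw [length_joinAbove, List.length_cons, add_left_inj] at hl
  simp only at hl
  rcases D with _ | ⟨d, D⟩
  · rcases L with _ | ⟨x, L⟩
    · exact hne rfl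
    · have := hlt x (by simp)
      have h2 : x = t.length := (List.cons.inj ht).1
      lia
  · have := (pairLength_lt hw.1).1 d (by simp)
    have h2 : d + L.length = t.length := (List.cons.inj ht).1
    lia

/-- Take b to be the largest ascent top. A letter above b cannot follow a smaller letter, so the
letters above b form a decreasing prefix. -/
theorem exists_ascent_split {L : List ℕ} (hnd : L.Nodup) (h : ¬ L.Pairwise (· > ·)) :
    ∃ b D L' a, L = D ++ L' ∧ (∀ x ∈ D, b < x) ∧ (∀ x ∈ L', x ≤ b) ∧ D.Pairwise (· > ·) ∧
      a < b ∧ [a, b].Sublist L' := by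
  classical
  set T := L.toFinset.filter fun b => ∃ a, a < b ∧ [a, b].Sublist L with hT
  have hTne : T.Nonempty := by
    rw [pairwise_gt_iff] at h
    push Not at h
    obtain ⟨x, y, hs, hxy⟩ := h
    have := hnd.sublist hs
    simp at this
    exact ⟨y, by simp only [hT, Finset.mem_filter, List.mem_toFinset]
                 exact ⟨hs.subset (by simp), x, by lia, hs⟩⟩
  obtain ⟨b, hb, hmax⟩ := T.exists_max_image id hTne
  simp only [hT, Finset.mem_filter, List.mem_toFinset, id] at hb hmax
  obtain ⟨-, a, hab, hs⟩ := hb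
  have hmax' : ∀ x y, [x, y].Sublist L → x < y → y ≤ b :=
    fun x y hxy hlt => hmax y ⟨hxy.subset (by simp), x, hlt, hxy⟩
  obtain ⟨D, L', rfl, hD, hL'⟩ := exists_append_of_pairwise (P := fun x => x ≤ b) (t := L) (by
    rw [List.pairwise_iff_forall_sublist]
    intro y z hyz hy
    by_contra hz
    exact hz (hmax' y z hyz (by lia)))
  refine ⟨b, D, L', a, rfl, fun x hx => not_le.1 (hD x hx), hL', ?_, hab, ?_⟩
  · rw [pairwise_gt_iff]
    intro x y hxy
    have h1 := hnd.sublist (hxy.trans (List.sublist_append_left _ _))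
    have h2 := hmax' x y (hxy.trans (List.sublist_append_left _ _))
    have h3 := hD y (hxy.subset (by simp))
    simp at h1
    lia
  · obtain ⟨l₁, l₂, h1, h2, h3⟩ := List.sublist_append_iff.1 hs
    rcases l₁ with _ | ⟨x, l₁⟩
    · rw [List.nil_append] at h1
      rwa [h1]
    · simp only [List.cons_append, List.cons.injEq] at h1
      exact absurd hab.le (hD a (h2.subset (by simp [h1.1])))

theorem exists_of_mem_coreWords {l : List ℕ} (hl : l ∈ coreWords) :
    (∃ w ∈ weakSlopePairs, joinMax w = l) ∨
      ∃ w ∈ coreWords ×ˢ slopePairs, joinAbove w = l := by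
  obtain ⟨hla, hne, hmax⟩ := hl
  have hn : l.length - 1 ∈ l := (hla.1.2 _).2 (by
    have := List.length_pos_iff.2 hne
    lia)
  obtain ⟨L, R, hLR⟩ := List.append_of_mem hn
  obtain rfl : l = joinMax (L, R) := by
    have h := congrArg List.length hLR
    simp at h
    rw [hLR, joinMax, pairLength, h]
    congr 2
  clear hn hLR
  have hs := std_joinMax_iff.1 hla.1
  have hLne : L ≠ [] := by
    rintro rfl
    exact hmax R (by simp [joinMax, pairLength])
  by_cases hLD : L.Pairwise (· > ·)
  · exact Or.inl ⟨(L, R), (joinMax_mem_avoidWords_iff hLne hLD).1 hla, rfl⟩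
  right
  obtain ⟨h3, h4⟩ := pairLength_lt hs
  have hnd := hs.1
  rw [List.nodup_append'] at hnd
  obtain ⟨b, D, L', a, rfl, hD, hL', hDd, hab, hsub⟩ := exists_ascent_split hnd.1 hLD
  have hbL' : b ∈ L' := hsub.subset (by simp)
  -- If r < b, the subsequence a b n r would be forbidden, with n the largest letter.
  have hR : ∀ r ∈ R, b + 1 ≤ r := by
    intro r hr
    have h5 := (hla.2 a b (pairLength (D ++ L', R)) r (by
      have h6 : [pairLength (D ++ L', R), r].Sublist (pairLength (D ++ L', R) :: R) :=
        (List.singleton_sublist.2 hr).cons_cons _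
      exact (hsub.trans (List.sublist_append_right D L')).append h6)).1
    have h6 := h3 b (List.mem_append_right _ hbL')
    have h7 : r ≠ b := fun h => hnd.2.2 (List.mem_append_right _ hbL') (h ▸ hr)
    lia
  have hlen : Std L' ∧ L'.length = b + 1 := by
    refine std_of_mem (List.nodup_append.1 hnd.1).2.1 fun x => ⟨fun hx => ?_, fun hx => ?_⟩
    · have := hL' x hx
      lia
    · have h6 := h3 b (List.mem_append_right _ hbL')
      have h7 := (hs.2 x).2 (by simp only [pairLength] at h6; simp at h6 ⊢; lia)
      rcases List.mem_append.1 h7 with h7 | h7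
      · rcases List.mem_append.1 h7 with h7 | h7
        · have := hD x h7
          lia
        · exact h7
      · have := hR x h7
        lia
  obtain ⟨hsL, hlen⟩ := hlen
  obtain ⟨D, rfl⟩ := exists_map_add_eq (k := L'.length) (t := D) (by rw [hlen]; exact hD)
  obtain ⟨R, rfl⟩ := exists_map_add_eq (k := L'.length) (t := R) (by rw [hlen]; exact hR)
  have hDd' : D.Pairwise (· > ·) := by
    rw [List.pairwise_map] at hDd
    exact hDd.imp (by simp)
  have he : joinMax (D.map (· + L'.length) ++ L', R.map (· + L'.length)) =
      joinAbove (L', D, R) := by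
    simp only [joinMax, joinAbove, List.append_assoc]
    congr 3
    simp [pairLength]
    lia
  rw [he] at hla ⊢
  have hL'ne : L' ≠ [] := List.ne_nil_of_mem hbL'
  obtain ⟨h5, h6⟩ := (joinAbove_mem_avoidWords_iff hL'ne (fun x hx => (hsL.2 x).1 hx) hDd').1 hla
  refine ⟨(L', D, R), ⟨⟨h5, hL'ne, fun t ht => ?_⟩, h6⟩, rfl⟩
  -- The largest letter `b` of `L'` is preceded by `a`, so it is not first: `L'` is again a core
  -- word.
  simp only at ht
  rw [ht, List.length_cons, add_left_inj] at hlen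
  have hnd' := hsL.1
  rw [ht, hlen, List.nodup_cons] at hnd'
  rw [ht, hlen] at hsub
  rcases List.cons_sublist_cons'.1 hsub with h | ⟨h, -⟩
  · exact hnd'.1 (h.subset (by simp))
  · lia

theorem coreWords_eq :
    coreWords = joinMax '' weakSlopePairs ∪ joinAbove '' (coreWords ×ˢ slopePairs) := by
  ext l
  constructor
  · intro hl
    exact exists_of_mem_coreWords hl
  · rintro (⟨w, hw, rfl⟩ | ⟨w, hw, rfl⟩)
    · exact joinMax_mem_coreWords hw
    · exact joinAbove_mem_coreWords hw.1 hw.2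

/-- Were `X` nonempty, the largest letter would exceed all of `L`, hence lie in `X` and be its first
letter. This pins down the boundary between the decreasing prefix and the core word in `joinAbove`.
-/
theorem eq_nil_of_append_mem_coreWords {X L : List ℕ} (h : X ++ L ∈ coreWords)
    (hL : ∀ x ∈ L, x < L.length) (hX : X.Pairwise (· > ·)) : X = [] := by
  rcases X with _ | ⟨x, X⟩
  · rfl
  exfalso
  obtain ⟨⟨⟨hnd, hmem⟩, -⟩, -, hmax⟩ := h
  have h1 := (hmem ((X ++ L).length)).2 (by simp)
  have h2 := (hmem x).1 (by simp)
  simp only [List.cons_append, List.mem_cons, List.mem_append, List.length_cons,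
    List.length_append] at h1 h2
  rw [List.pairwise_cons] at hX
  rcases h1 with h1 | h1 | h1
  · refine hmax (X ++ L) ?_
    rw [List.length_append, h1, List.cons_append]
  · have := hX.1 _ h1
    lia
  · have := hL _ h1
    lia

theorem joinMax_injOn : Set.InjOn joinMax weakSlopePairs := by
  rintro ⟨D, R⟩ hw ⟨D', R'⟩ hw' h
  have hl : pairLength (D, R) = pairLength (D', R') := by
    have := congrArg List.length h
    simpa [length_joinMax] using this
  have h1 := (pairLength_lt hw.2.1).1
  have h2 := (pairLength_lt hw'.2.1).1
  rw [joinMax, joinMax, hl] at h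
  rw [hl] at h1
  obtain ⟨h3, -, h4⟩ := append_cons_inj h1 h2 (lt_irrefl _) (lt_irrefl _) h
  exact Prod.ext h3 h4

theorem joinAbove_lt {L D R : List ℕ} (hL : L ∈ coreWords) (hw : (D, R) ∈ slopePairs) :
    ∀ x ∈ D.map (· + L.length) ++ L, x < L.length + pairLength (D, R) := by
  intro x hx
  rcases List.mem_append.1 hx with hx | hx
  · obtain ⟨y, hy, rfl⟩ := List.mem_map.1 hx
    have := (pairLength_lt hw.1).1 y hy
    lia
  · have := (hL.1.1.2 x).1 hx
    lia

theorem joinAbove_injOn : Set.InjOn joinAbove (coreWords ×ˢ slopePairs) := by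
  rintro ⟨L, D, R⟩ ⟨hL, hw⟩ ⟨L', D', R'⟩ ⟨hL', hw'⟩ h
  simp only at hL hw hL' hw'
  have hl : L.length + pairLength (D, R) = L'.length + pairLength (D', R') := by
    have := congrArg List.length h
    simpa [length_joinAbove] using this
  have h1 := joinAbove_lt hL hw
  have h2 := joinAbove_lt hL' hw'
  simp only [joinAbove] at h
  rw [hl, ← List.append_assoc, ← List.append_assoc] at h
  rw [hl] at h1
  obtain ⟨h3, -, h4⟩ := append_cons_inj h1 h2 (lt_irrefl _) (lt_irrefl _) h
  have hdec : ∀ {D : List ℕ} {k : ℕ}, D.Pairwise (· > ·) → (D.map (· + k)).Pairwise (· > ·) := by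
    intro D k hD
    rw [List.pairwise_map]
    exact hD.imp (by simp)
  have key : D.map (· + L.length) = D'.map (· + L'.length) ∧ L = L' := by
    rcases List.append_eq_append_iff.1 h3 with ⟨Y, h5, h6⟩ | ⟨Y, h5, h6⟩
    · have hY : Y = [] := by
        refine eq_nil_of_append_mem_coreWords (L := L') (h6 ▸ hL)
          (fun x hx => (hL'.1.1.2 x).1 hx) ?_
        have := hdec (k := L'.length) hw'.2.1
        rw [h5] at this
        exact (List.pairwise_append.1 this).2.1
      subst hY
      rw [List.append_nil] at h5
      exact ⟨h5.symm, by simpa using h6⟩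
    · have hY : Y = [] := by
        refine eq_nil_of_append_mem_coreWords (L := L) (h6 ▸ hL')
          (fun x hx => (hL.1.1.2 x).1 hx) ?_
        have := hdec (k := L.length) hw.2.1
        rw [h5] at this
        exact (List.pairwise_append.1 this).2.1
      subst hY
      rw [List.append_nil] at h5
      exact ⟨h5, by simpa using h6.symm⟩
  obtain ⟨h5, rfl⟩ := key
  rw [map_add_injective _ h5, map_add_injective _ h4]

/-- The prefix before the largest letter is decreasing in the first image. In the second it ends in
a core word, which is never decreasing. -/
theorem disjoint_joinMax_joinAbove :
    Disjoint (joinMax '' weakSlopePairs) (joinAbove '' (coreWords ×ˢ slopePairs)) := by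
  refine Set.disjoint_left.2 ?_
  rintro _ ⟨⟨D, R⟩, hw, rfl⟩ ⟨⟨L', D', R'⟩, ⟨hL', hw'⟩, h⟩
  simp only at hL' hw'
  have hl : L'.length + pairLength (D', R') = pairLength (D, R) := by
    have := congrArg List.length h
    simpa [length_joinAbove, length_joinMax] using this
  have h1 := joinAbove_lt hL' hw'
  simp only [joinAbove] at h
  rw [hl, joinMax, ← List.append_assoc] at h
  rw [hl] at h1
  obtain ⟨h3, -, -⟩ := append_cons_inj h1 (pairLength_lt hw.2.1).1 (lt_irrefl _) (lt_irrefl _) h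
  have hD : D.Pairwise (· > ·) := hw.2.2.1
  change _ = D at h3
  rw [← h3] at hD
  exact hL'.2.1 (eq_nil_of_append_mem_coreWords (L := []) (by simpa using hL') (by simp)
    (List.pairwise_append.1 hD).2.1)

/-! ### Functional equations for the avoiders -/

theorem cons_mem_avoidWords_iff {t : List ℕ} : t.length :: t ∈ avoidWords ↔ t ∈ avoidWords := by
  have h : Std (t.length :: t) ↔ Std t := by
    simpa [joinMax, pairLength] using std_joinMax_iff (D := []) (R := t)
  constructor
  · rintro ⟨h1, h2⟩
    exact ⟨h.1 h1, h2.sublist (List.sublist_cons_self _ _)⟩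
  · rintro ⟨h1, h2⟩
    exact ⟨h.2 h1, (avoid_cons_iff fun x hx => (h1.2 x).1 hx).2 h2⟩

theorem gradedFinite_avoidWords : GradedFinite List.length avoidWords :=
  gradedFinite_std.mono fun _ h => h.1

theorem gradedFinite_coreWords : GradedFinite List.length coreWords :=
  gradedFinite_avoidWords.mono fun _ h => h.1

theorem gf_coreWords : gf List.length coreWords = X * gf pairLength weakSlopePairs +
    X * (gf List.length coreWords * gf pairLength slopePairs) := by
  have h1 : ∀ w ∈ weakSlopePairs, (joinMax w).length = pairLength w + 1 := fun w _ =>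
    length_joinMax w
  have h2 : ∀ w ∈ coreWords ×ˢ slopePairs,
      (joinAbove w).length = w.1.length + pairLength w.2 + 1 := fun w _ => length_joinAbove w
  conv_lhs => rw [coreWords_eq]
  rw [gf_union (gradedFinite_weakSlopePairs.image h1)
    ((gradedFinite_coreWords.prod gradedFinite_slopePairs).image h2) disjoint_joinMax_joinAbove,
    gf_image joinMax_injOn h1,
    gf_image (size := fun w : List ℕ × (List ℕ × List ℕ) => w.1.length + pairLength w.2)
      joinAbove_injOn h2,
    gf_prod gradedFinite_coreWords gradedFinite_slopePairs, pow_one]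

theorem gf_avoidWords : gf List.length avoidWords =
    1 + X * gf List.length avoidWords + gf List.length coreWords := by
  have hi : Set.InjOn (fun t : List ℕ => t.length :: t) avoidWords :=
    fun t _ t' _ h => (List.cons.inj h).2
  have hs : ∀ t ∈ avoidWords, (t.length :: t).length = t.length + 1 := fun t _ => rfl
  have key : avoidWords =
      {[]} ∪ (fun t : List ℕ => t.length :: t) '' avoidWords ∪ coreWords := by
    ext l
    constructor
    · intro hl
      by_cases h1 : l = []
      · exact Or.inl (Or.inl h1)
      by_cases h2 : ∃ t : List ℕ, l = t.length :: t
      · obtain ⟨t, rfl⟩ := h2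
        exact Or.inl (Or.inr ⟨t, cons_mem_avoidWords_iff.1 hl, rfl⟩)
      · exact Or.inr ⟨hl, h1, fun t ht => h2 ⟨t, ht⟩⟩
    · rintro ((rfl | ⟨t, ht, rfl⟩) | hl)
      · exact ⟨std_nil, fun a b c d h => by simp at h⟩
      · exact cons_mem_avoidWords_iff.2 ht
      · exact hl.1
  conv_lhs => rw [key]
  rw [gf_union ((gradedFinite_singleton _).union (gradedFinite_avoidWords.image hs))
    gradedFinite_coreWords, gf_union (gradedFinite_singleton _) (gradedFinite_avoidWords.image hs),
    gf_singleton, gf_image hi hs, pow_one]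
  · simp
  · refine Set.disjoint_left.2 ?_
    rintro _ rfl ⟨t, -, ht⟩
    simp at ht
  · refine Set.disjoint_left.2 ?_
    rintro _ (rfl | ⟨t, -, rfl⟩) ⟨-, h1, h2⟩
    · exact h1 rfl
    · exact h2 t rfl

/-! ### Solving for the generating function -/

theorem mk_two_pow_mul : (PowerSeries.mk fun m => (2 : ℚ) ^ m) * (1 - 2 * X) = 1 := by
  have h2 : (2 : ℚ⟦X⟧) = C 2 := by rw [map_ofNat]
  ext n
  rw [mul_sub, mul_one, map_sub, coeff_mk, h2, mul_left_comm, coeff_C_mul]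
  cases n with
  | zero => simp
  | succ n =>
    rw [coeff_succ_mul_X, coeff_mk, coeff_one, if_neg (Nat.succ_ne_zero n)]
    ring

theorem mk_succ_mul : (PowerSeries.mk fun m => (m : ℚ) + 1) * (1 - X) = PowerSeries.mk 1 := by
  ext n
  rw [mul_sub, mul_one, map_sub, coeff_mk, coeff_mk]
  cases n with
  | zero => simp
  | succ n =>
    rw [coeff_succ_mul_X, coeff_mk]
    simp

theorem mk_one_mul : (PowerSeries.mk 1 : ℚ⟦X⟧) * (1 - X) = 1 :=
  PowerSeries.mk_one_mul_one_sub_eq_one ℚ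

theorem mk_lowSets_mul :
    (PowerSeries.mk fun m => (2 : ℚ) ^ m - 1) * ((1 - X) * (1 - 2 * X)) = X := by
  have h : (PowerSeries.mk fun m => (2 : ℚ) ^ m - 1) =
      (PowerSeries.mk fun m => (2 : ℚ) ^ m) - PowerSeries.mk 1 := by
    ext
    simp
  rw [h]
  linear_combination (1 - X) * mk_two_pow_mul - (1 - 2 * X) * mk_one_mul

theorem mk_midSets_mul :
    (PowerSeries.mk fun m => (2 : ℚ) ^ m - (m + 1)) * ((1 - X) * ((1 - X) * (1 - 2 * X))) =
      X ^ 2 := by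
  have h : (PowerSeries.mk fun m => (2 : ℚ) ^ m - (m + 1)) =
      (PowerSeries.mk fun m => (2 : ℚ) ^ m) - PowerSeries.mk fun m => (m : ℚ) + 1 := by
    ext
    simp
  rw [h]
  linear_combination (1 - X) ^ 2 * mk_two_pow_mul - (1 - X) * (1 - 2 * X) * mk_succ_mul -
    (1 - 2 * X) * mk_one_mul

/-- Both sides square to 1 - 4X, and their sum has constant term 2, which rules out the opposite
sign. -/
theorem sqrtOneSubFourX_eq : sqrtOneSubFourX = 1 - 2 * X * gf List.length catWords := by
  have h : (sqrtOneSubFourX - (1 - 2 * X * gf List.length catWords)) *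
      (sqrtOneSubFourX + (1 - 2 * X * gf List.length catWords)) = 0 := by
    linear_combination sqrtOneSubFourX_sq + 4 * X * gf_catWords
  rcases mul_eq_zero.1 h with h | h
  · exact sub_eq_zero.1 h
  · have := congrArg PowerSeries.constantCoeff h
    rw [map_add, constantCoeff_sqrtOneSubFourX] at this
    norm_num at this

theorem gf_avoidWords_mul : gf List.length avoidWords *
      (2 * (1 - X) ^ 2 * X * (1 - 7 * X + 14 * X ^ 2 - 9 * X ^ 3)) =
    (1 - 2 * X) * ((1 - 5 * X + 9 * X ^ 2 - 6 * X ^ 3) * sqrtOneSubFourX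
      - (1 - 9 * X + 29 * X ^ 2 - 38 * X ^ 3 + 18 * X ^ 4)) := by
  have hC := gf_catWords
  have hH := gf_thresholdWords
  have hF := gf_avoidWords
  have hN := gf_coreWords
  have hE := gf_slopePairs
  have hB := gf_weakSlopePairs
  have hK := mk_one_mul
  have hP := mk_lowSets_mul
  have hQ := mk_midSets_mul
  rw [sqrtOneSubFourX_eq]
  generalize gf List.length catWords = C at *
  generalize gf (fun w : ℕ × List ℕ => w.2.length) thresholdWords = H at *
  generalize gf List.length avoidWords = F at *
  generalize gf List.length coreWords = N at *
  generalize gf pairLength slopePairs = E at *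
  generalize gf pairLength weakSlopePairs = B at *
  generalize (PowerSeries.mk fun m => (2 : ℚ) ^ m - 1) = P at *
  generalize (PowerSeries.mk fun m => (2 : ℚ) ^ m - (m + 1)) = Q at *
  generalize (PowerSeries.mk 1 : ℚ⟦X⟧) = K at *
  set d : ℚ⟦X⟧ := (1 - X) * (1 - 2 * X) with hd
  have hE' : E * d = (1 - X) * C - X := by
    linear_combination d * hE + (1 - 2 * X) * C * hK + (C - 1) * hP
  have hB' : B * ((1 - X) * d) = X * d * H + X ^ 2 * (C - 1) := by
    linear_combination (1 - X) * d * hB + X * d * H * hK + (C - 1) * hQ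
  -- Eliminates E, B and H with denominators cleared; H has denominator 1 - X - XC.
  have hN' : N * ((1 - X) * (d - X * ((1 - X) * C - X)) * (1 - X - X * C)) =
      X ^ 2 * (d + X * (C - 1) * (1 - X - X * C)) := by
    linear_combination (1 - X) * d * (1 - X - X * C) * hN +
      (1 - X) * (1 - X - X * C) * X * N * hE' + (1 - X - X * C) * X * hB' + X ^ 2 * d * hH
  have hne : (1 - X) * (d - X * ((1 - X) * C - X)) * (1 - X - X * C) ≠ 0 := by
    intro h
    have := congrArg PowerSeries.constantCoeff h
    simp [hd] at this
  refine mul_right_cancel₀ hne ?_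
  rw [hd] at hN' ⊢
  -- After F and N are eliminated, an identity cubic in C remains; the coefficient of `hC` is its
  -- quotient by the quadratic relation for C.
  linear_combination 2 * (1 - X) * X * (1 - 7 * X + 14 * X ^ 2 - 9 * X ^ 3) *
      ((1 - X) * ((1 - X) * (1 - 2 * X) - X * ((1 - X) * C - X)) * (1 - X - X * C)) * hF +
    2 * (1 - X) * X * (1 - 7 * X + 14 * X ^ 2 - 9 * X ^ 3) * hN' -
    (-2 * X + 22 * X ^ 2 - 108 * X ^ 3 + 300 * X ^ 4 - 500 * X ^ 5 + 494 * X ^ 6 - 266 * X ^ 7 + 60 * X ^ 8 + (2 * X ^ 2 - 18 * X ^ 3 + 68 * X ^ 4 - 138 * X ^ 5 + 158 * X ^ 6 - 96 * X ^ 7 + 24 * X ^ 8) * C) * hC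

end PatternAvoidance

/-- The identity is stated in the field of formal Laurent series over `ℚ`, where the division by
the (nonzero) denominator is a genuine one; `X` is the indeterminate `x`. -/
theorem mainTheorem9 :
    ((PatternAvoidance.genFun PatternAvoidance.patterns : ℚ⟦X⟧) : LaurentSeries ℚ) =
      (((1 - 2 * X) *
          ((1 - 5 * X + 9 * X ^ 2 - 6 * X ^ 3) * PatternAvoidance.sqrtOneSubFourX
            - (1 - 9 * X + 29 * X ^ 2 - 38 * X ^ 3 + 18 * X ^ 4)) : ℚ⟦X⟧) : LaurentSeries ℚ) /
        ((2 * (1 - X) ^ 2 * X * (1 - 7 * X + 14 * X ^ 2 - 9 * X ^ 3) : ℚ⟦X⟧) :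
          LaurentSeries ℚ) := by
  have hne : (2 * (1 - X) ^ 2 * X * (1 - 7 * X + 14 * X ^ 2 - 9 * X ^ 3) : ℚ⟦X⟧) ≠ 0 := by
    have h2 : (2 : ℚ⟦X⟧) ≠ 0 := fun h => by
      have := congrArg PowerSeries.constantCoeff h
      rw [map_ofNat] at this
      norm_num at this
    have h1 : (1 - X : ℚ⟦X⟧) ≠ 0 := fun h => by
      simpa using congrArg PowerSeries.constantCoeff h
    have h3 : (1 - 7 * X + 14 * X ^ 2 - 9 * X ^ 3 : ℚ⟦X⟧) ≠ 0 := fun h => by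
      simpa using congrArg PowerSeries.constantCoeff h
    exact mul_ne_zero (mul_ne_zero (mul_ne_zero h2 (pow_ne_zero 2 h1)) PowerSeries.X_ne_zero) h3
  rw [eq_div_iff (fun h => hne (HahnSeries.ofPowerSeries_injective (h.trans (map_zero _).symm))),
    ← PowerSeries.coe_mul, PatternAvoidance.genFun_patterns]
  exact congrArg _ PatternAvoidance.gf_avoidWords_mul
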